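/- **Setting.** Let $d\in\mathbb N$, $L>0$, let $\Omega=(\mathbb R/L\mathbb Z)^d$ with Lebesgue measure, $\rho_\infty=L^{-d}$, and let $W\in C^2(\Omega)$ be real-valued, even along every coordinate and of mean zero. Let $\mathbb N\ni 0$. For $k\in\mathbb Z^d$ put $\Theta(k)=\prod_{i=1}^d(2-\delta_{k_i,0})^{1/2}$, $N_k=L^{-d/2}\,\Theta(k)$ and $e_k(x)=N_k\prod_{i=1}^d e_{k_i}(x_i)$, where $e_{n}(t)=\cos(2\pi n t/L)$ for $n>0$, $e_0(t)=1$, and $e_n(t)=\sin(2\pi n t/L)$ for $n<0$. Write $\hat f(k)=\int_\Omega f e_k\,dx$. For $m>1$ and $\beta>0$ let $$\mathcal F_\beta^m(\rho)=\frac{\beta^{-1}}{m-1}\int_\Omega\rho^m\,dx-\frac{\beta^{-1}}{m-1}+\frac12\iint_{\Omega\times\Omega}W(x-y)\rho(x)\rho(y)\,dx\,dy$$ for Borel probability measures $\rho$ on $\Omega$ with a density (also denoted $\rho$) in $L^m(\Omega)$, and $\mathcal F_\beta^m(\rho)=+\infty$ for all other Borel probability measures. Minimisers are taken over all Borel probability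 measures on $\Omega$. The measure with constant density $\rho_\infty$ is also denoted $\rho_\infty$. A number $\beta_c>0$ is a *transition point* of $\mathcal F^m_\beta$ if (i) $\rho_\infty$ is the unique minimiser of $\mathcal F_\beta^m$ for $0<\beta<\beta_c$; (ii) $\rho_\infty$ is a minimiser for $\beta=\beta_c$; (iii) for every $\beta>\beta_c$ there is a minimiser $\rho_\beta\ne\rho_\infty$. It is a *continuous* transition point if in addition $\rho_\infty$ is the unique minimiser at $\beta=\beta_c$ and every family $(\rho_\beta)_{\beta>\beta_c}$ of minimisers satisfies $\limsup_{\beta\to\beta_c^+}\|\rho_\beta-\rho_\infty\|_{L^\infty(\Omega)}=0$. Put $$\beta_\sharp^m=-\frac{m\,\rho_\infty^{m-3/2}}{\min_{k\in\mathbb N^d,\,k\ne0}\hat W(k)/\Theta(k)}.$$ For $\sigma\in\{1,-1\}^d$ and $k\in\mathbb Z^d$ let $\sigma(k)=(\sigma_ik_i)_i$, and let products of sign vectors be coordinatewise. For $k\in\mathbb N^d\setminus\{0\}$ let $$P_2(k)=\{j\in\mathbb N^d: j\neq0,\ j_i\in\{2k_i,0\}\ \forall i\},\qquad P_3(k)=\{\ell\in\mathbb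 N^d:\ell\ne k,\ \ell_i\in\{3k_i,k_i\}\ \forall i\}.$$ For $j\in P_2(k)$ and $\ell\in P_3(k)$ let $c_j^{\sigma_1,\sigma_2}$ be the coefficient of $e_{\sigma_1\sigma_2(j)}$ in the expansion of $e_{\sigma_1(k)}e_{\sigma_2(k)}$, and $c_\ell^{\sigma_1,\sigma_2,\sigma_3}$ the coefficient of $e_{\sigma_1\sigma_2\sigma_3(\ell)}$ in the expansion of $e_{\sigma_1(k)}e_{\sigma_2(k)}e_{\sigma_3(k)}$, in the orthonormal basis $(e_q)_{q\in\mathbb Z^d}$ of $L^2(\Omega)$. **Theorem ($m=4$).** Suppose that $\hat W(k)<0$ for some $k\in\mathbb Z^d\setminus\{0\}$, and let $\beta_c\in(0,\infty)$ be a transition point of $\mathcal F_\beta^4$. Assume that $\hat W(k)/\Theta(k)$, $k\in\mathbb N^d\setminus\{0\}$, attains its minimum at a unique mode $k^\sharp$, that $\hat W(k)\ge0$ for all $k\in\mathbb N^d$, $k\ne k^\sharp$, and that, with $P_2=P_2(k^\sharp)$, $P_3=P_3(k^\sharp)$ and the constants $c$ taken for $k=k^\sharp$, $$\hat W(j)>\max_{\sigma_1,\sigma_2\in\{1,-1\}^d}\frac{6\,\Theta(j)^5\,(c_j^{\sigma_1,\sigma_2})^2\,|P_2\cup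 P_3|}{\rho_\infty\,\Theta(k^\sharp)}\,|\hat W(k^\sharp)|\qquad\forall j\in P_2,\tag{A2}$$ $$\hat W(\ell)>\max_{\sigma_1,\sigma_2,\sigma_3\in\{1,-1\}^d}\frac{2\,\Theta(\ell)^9\,\Theta(k^\sharp)\,(c_\ell^{\sigma_1,\sigma_2,\sigma_3})^2\,|P_2\cup P_3|}{3\,\rho_\infty^2}\,|\hat W(k^\sharp)|\qquad\forall \ell\in P_3.\tag{A3}$$ Then $\beta_c=\beta_\sharp^4$, and $\beta_c$ is a continuous transition point of $\mathcal F_\beta^4$. -/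

import Mathlib

open MeasureTheory Filter Topology
open scoped ENNReal

namespace PorousTransition

noncomputable section

/-- The `d`-dimensional torus of side length `L`; its `volume` is Lebesgue measure, of total
mass `L ^ d`. -/
abbrev Torus (d : ℕ) (L : ℝ) : Type := Fin d → AddCircle L

/-! ### The trigonometric basis -/

/-- The one-dimensional factors: `cos (2 π k x / L)` if `k > 0`, `1` if `k = 0`, and
`sin (2 π k x / L)` if `k < 0` (real and imaginary part of `exp (2 π i k x / L)`). -/
def trig1 {L : ℝ} (k : ℤ) (x : AddCircle L) : ℝ :=
  if 0 < k then (fourier k x).re else if k = 0 then 1 else (fourier k x).im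

/-- `Θ(k) = ∏ i, (2 - δ_{k i, 0}) ^ (1/2)`. -/
def Theta {d : ℕ} (k : Fin d → ℤ) : ℝ :=
  ∏ i, Real.sqrt (2 - if k i = 0 then 1 else 0)

/-- The normalisation `N_k = Θ(k) / L ^ (d / 2)`. -/
def normConst {d : ℕ} (L : ℝ) (k : Fin d → ℤ) : ℝ :=
  Theta k / L ^ ((d : ℝ) / 2)

/-- The orthonormal basis function `e_k(x) = N_k ∏ i, e_{k i}(x i)`, for `k ∈ ℤ^d`. -/
def basisFn {d : ℕ} {L : ℝ} (k : Fin d → ℤ) (x : Torus d L) : ℝ :=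
  normConst L k * ∏ i, trig1 (k i) (x i)

/-- The (real) Fourier coefficient `⟨f, e_k⟩` in `L²` of the torus. -/
def coeff {d : ℕ} {L : ℝ} [Fact (0 < L)] (f : Torus d L → ℝ) (k : Fin d → ℤ) : ℝ :=
  ∫ x, f x * basisFn k x

/-- The inclusion `ℕ^d ⊆ ℤ^d`. -/
def natMode {d : ℕ} (k : Fin d → ℕ) : Fin d → ℤ := fun i => (k i : ℤ)

/-- The action of a vector of signs `σ ∈ {1, -1}^d` on a mode `k ∈ ℤ^d`, coordinate by
coordinate. -/
def flipMode {d : ℕ} (σ : Fin d → ℤˣ) (k : Fin d → ℤ) : Fin d → ℤ :=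
  fun i => (σ i : ℤ) * k i

/-! ### Harmonics of a mode -/

/-- `P₂(k)`: the nonzero `j ∈ ℕ^d` with `j i ∈ {2 k i, 0}` for every `i`. -/
def P2 {d : ℕ} (k : Fin d → ℕ) : Finset (Fin d → ℕ) :=
  (Fintype.piFinset fun i => {2 * k i, 0}).erase 0

/-- `P₃(k)`: the `ℓ ∈ ℕ^d`, `ℓ ≠ k`, with `ℓ i ∈ {3 k i, k i}` for every `i`. -/
def P3 {d : ℕ} (k : Fin d → ℕ) : Finset (Fin d → ℕ) :=
  (Fintype.piFinset fun i => {3 * k i, k i}).erase k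

/-- For `j ∈ P₂(k)`, the coefficient `c_j^{σ₁,σ₂}` of `e_{σ₁σ₂(j)}` in the expansion of the
product `e_{σ₁(k)} e_{σ₂(k)}` in the orthonormal basis. These are the coefficients in
`(∑_σ a_σ e_{σ(k)})² = ∑_j ∑_{σ₁,σ₂} a_{σ₁} a_{σ₂} c_j^{σ₁,σ₂} e_{σ₁σ₂(j)} + C₀ e_0`. -/
def c2 {d : ℕ} (L : ℝ) [Fact (0 < L)] (k : Fin d → ℕ) (σ₁ σ₂ : Fin d → ℤˣ)
    (j : Fin d → ℕ) : ℝ :=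
  coeff (fun x : Torus d L =>
      basisFn (flipMode σ₁ (natMode k)) x * basisFn (flipMode σ₂ (natMode k)) x)
    (flipMode (σ₁ * σ₂) (natMode j))

/-- For `ℓ ∈ P₃(k)`, the coefficient `c_ℓ^{σ₁,σ₂,σ₃}` of `e_{σ₁σ₂σ₃(ℓ)}` in the expansion of the
product `e_{σ₁(k)} e_{σ₂(k)} e_{σ₃(k)}` in the orthonormal basis. -/
def c3 {d : ℕ} (L : ℝ) [Fact (0 < L)] (k : Fin d → ℕ) (σ₁ σ₂ σ₃ : Fin d → ℤˣ)
    (l : Fin d → ℕ) : ℝ :=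
  coeff (fun x : Torus d L =>
      basisFn (flipMode σ₁ (natMode k)) x * basisFn (flipMode σ₂ (natMode k)) x *
        basisFn (flipMode σ₃ (natMode k)) x)
    (flipMode (σ₁ * σ₂ * σ₃) (natMode l))

/-! ### Interaction potentials -/

/-- Admissible interaction potentials: twice continuously differentiable on the torus (i.e. the
periodic lift to `ℝ^d` is `C²`), even along every coordinate, and of mean zero. -/
structure IsPotential {d : ℕ} {L : ℝ} [Fact (0 < L)] (W : Torus d L → ℝ) : Prop where
  contDiff : ContDiff ℝ 2 fun x : Fin d → ℝ => W fun i => (x i : AddCircle L)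
  even : ∀ (i : Fin d) (x : Torus d L), W (Function.update x i (-(x i))) = W x
  mean_zero : ∫ x, W x = 0

/-- `H`-stability: all nonzero Fourier modes are nonnegative. -/
def HStable {d : ℕ} {L : ℝ} [Fact (0 < L)] (W : Torus d L → ℝ) : Prop :=
  ∀ k : Fin d → ℤ, k ≠ 0 → 0 ≤ coeff W k

/-! ### The free energy and its minimisers -/

/-- The constant density `ρ_∞ = L ^ (-d)`. -/
def flatDensity (d : ℕ) (L : ℝ) : ℝ := (L ^ d)⁻¹

/-- The flat state: the probability measure with constant density `ρ_∞`. -/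
def flatState (d : ℕ) (L : ℝ) [hL : Fact (0 < L)] : ProbabilityMeasure (Torus d L) :=
  ⟨(volume : Measure (Torus d L)).withDensity fun _ => ENNReal.ofReal (flatDensity d L), by
    constructor
    have hd : 0 < L ^ d := pow_pos hL.out d
    rw [withDensity_const, Measure.smul_apply, volume_pi, Measure.pi_univ]
    simp only [AddCircle.measure_univ, Finset.prod_const, Finset.card_univ, Fintype.card_fin,
      smul_eq_mul, flatDensity]
    rw [← ENNReal.ofReal_pow hL.out.le, ← ENNReal.ofReal_mul (inv_nonneg.2 hd.le),
      inv_mul_cancel₀ hd.ne', ENNReal.ofReal_one]⟩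

/-- The Lebesgue density of the absolutely continuous part of a probability measure. -/
def density {d : ℕ} {L : ℝ} [Fact (0 < L)] (ρ : ProbabilityMeasure (Torus d L)) :
    Torus d L → ℝ :=
  fun x => ((ρ : Measure (Torus d L)).rnDeriv volume x).toReal

/-- The free energy (for `m > 1`)
`F_β^m(ρ) = β⁻¹/(m-1) ∫ ρ^m - β⁻¹/(m-1) + 1/2 ∬ W(x-y) ρ(x) ρ(y)` on the Borel probability
measures, with value `+∞` unless `ρ` is absolutely continuous with density in `L^m`. -/
def freeEnergy {d : ℕ} {L : ℝ} [Fact (0 < L)] (W : Torus d L → ℝ) (m β : ℝ)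
    (ρ : ProbabilityMeasure (Torus d L)) : EReal :=
  open Classical in
  if (ρ : Measure (Torus d L)) ≪ volume ∧ MemLp (density ρ) (ENNReal.ofReal m) volume then
    ((β⁻¹ / (m - 1) * (∫ x, density ρ x ^ m) - β⁻¹ / (m - 1) +
      1 / 2 * ∫ x, ∫ y, W (x - y) * density ρ x * density ρ y : ℝ) : EReal)
  else ⊤

/-- `ρ` minimises `F_β^m` over all Borel probability measures on the torus. -/
def IsMinimiser {d : ℕ} {L : ℝ} [Fact (0 < L)] (W : Torus d L → ℝ) (m β : ℝ)
    (ρ : ProbabilityMeasure (Torus d L)) : Prop :=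
  ∀ ν : ProbabilityMeasure (Torus d L), freeEnergy W m β ρ ≤ freeEnergy W m β ν

/-- `ρ` is the unique minimiser of `F_β^m`. -/
def IsUniqueMinimiser {d : ℕ} {L : ℝ} [Fact (0 < L)] (W : Torus d L → ℝ) (m β : ℝ)
    (ρ : ProbabilityMeasure (Torus d L)) : Prop :=
  IsMinimiser W m β ρ ∧ ∀ ν, IsMinimiser W m β ν → ν = ρ

/-! ### Transition points -/

/-- `βc > 0` is a transition point of `F_β^m`. -/
structure IsTransitionPoint {d : ℕ} {L : ℝ} [Fact (0 < L)] (W : Torus d L → ℝ) (m βc : ℝ) :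
    Prop where
  pos : 0 < βc
  below : ∀ β, 0 < β → β < βc → IsUniqueMinimiser W m β (flatState d L)
  critical : IsMinimiser W m βc (flatState d L)
  above : ∀ β, βc < β → ∃ ρ, ρ ≠ flatState d L ∧ IsMinimiser W m β ρ

/-- `βc` is a continuous transition point of `F_β^m`: a transition point at which the flat state
is the unique minimiser, and such that every family of minimisers `(ρ_β)_{β > βc}` satisfies
`limsup_{β → βc⁺} ‖ρ_β - ρ_∞‖_{L^∞} = 0`. -/
structure IsContinuousTransitionPoint {d : ℕ} {L : ℝ} [Fact (0 < L)] (W : Torus d L → ℝ)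
    (m βc : ℝ) : Prop where
  isTransitionPoint : IsTransitionPoint W m βc
  unique : IsUniqueMinimiser W m βc (flatState d L)
  continuous : ∀ ρ : ℝ → ProbabilityMeasure (Torus d L),
    (∀ β, βc < β → IsMinimiser W m β (ρ β)) →
      limsup (fun β => eLpNorm (fun x => density (ρ β) x - flatDensity d L) ∞ volume)
        (𝓝[>] βc) = 0

/-- The point of critical stability
`β_♯^m = - m ρ_∞^(m - 3/2) / min_{k ∈ ℕ^d, k ≠ 0} (Ŵ(k) / Θ(k))`. -/
def betaSharp {d : ℕ} {L : ℝ} [Fact (0 < L)] (W : Torus d L → ℝ) (m : ℝ) : ℝ :=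
  -(m * flatDensity d L ^ (m - 3 / 2)) /
    ⨅ k : {k : Fin d → ℕ // k ≠ 0}, coeff W (natMode k.1) / Theta (natMode k.1)

end

end PorousTransition

set_option linter.unusedSectionVars false

namespace PorousTransition

noncomputable section

open scoped ComplexConjugate

variable {d : ℕ} {L : ℝ}

/-! ### Characters of the torus -/

/-! Write r = ρ_∞, k = k♯, let -κ be the complex Fourier coefficient of W on the modes σ(k), and put
b = κ/(4r²); then b⁻¹ = β♯ (`betaSharp_four_eq`). For a density r + f the excess energy over the
flat state is β⁻¹/3 ∫ (6r²f² + 4rf³ + f⁴) + ½ ∫ f (W∗f). At β⁻¹ = b its quadratic part degenerates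
on the modes σ(k), and everything rests on `coercivity`: the excess is still at least (b/72) ∫ f⁴.

To see this, let u, v₂, v₃ be the projections of f on the modes of k, of P₂(k) and of P₃(k). The
frequencies of u² are zero or second harmonics, those of u³ are modes of k or third harmonics. Hence
∫ u³ = 0, ∫ u²f = ∫ u²v₂ and ∫ u³f = ∫ u³(u + v₃) (`integral_projections`). Adding suitable
multiples of these identities makes the integrand pointwise at least a multiple of f⁴
(`coercivity_pointwise`), provided that the cross terms u²v₂ and u³v₃ are paid for by the spectral
gaps 24κ and (4/3)Θ(k)⁶κ. These gaps follow from (A2) and (A3) (`spectralGap`). The cubic cross term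
also needs |u| ≤ rΘ(k)², which holds because r + f is a probability density
(`abs_trigProj_modes_le`).

The entropy part is nonnegative, so the flat state is the unique minimiser up to and including b⁻¹
(`unique_minimiser_of_le`), which excludes βc < b⁻¹; minimality of the flat state at βc excludes βc
> b⁻¹ (`linear_stability`). Slightly above b⁻¹, coercivity keeps minimisers close to r in L⁴, hence
in L¹, and the Euler–Lagrange conditions turn this into uniform closeness
(`minimiser_uniform_bound`, `minimisers_tendsto`). -/

/-- The character `x ↦ exp (2 π i n · x / L)` of the torus. -/
def torusChar (n : Fin d → ℤ) : C(Torus d L, ℂ) where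
  toFun x := ∏ i, fourier (n i) (x i)
  continuous_toFun := by fun_prop

lemma torusChar_apply (n : Fin d → ℤ) (x : Torus d L) :
    torusChar n x = ∏ i, fourier (n i) (x i) := rfl

lemma torusChar_neg (n : Fin d → ℤ) (x : Torus d L) :
    torusChar (-n) x = conj (torusChar n x) := by
  simp only [torusChar_apply, Pi.neg_apply, fourier_neg, map_prod]

lemma torusChar_add (m n : Fin d → ℤ) :
    torusChar (m + n) = torusChar (L := L) m * torusChar n := by
  ext x
  simp only [torusChar_apply, Pi.add_apply, fourier_add, ContinuousMap.mul_apply,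
    ← Finset.prod_mul_distrib]

lemma torusChar_zero : torusChar (0 : Fin d → ℤ) = (1 : C(Torus d L, ℂ)) := by
  ext x
  simp [torusChar_apply]

lemma norm_torusChar (n : Fin d → ℤ) (x : Torus d L) : ‖torusChar n x‖ = 1 := by
  rw [torusChar_apply, norm_prod]
  exact Finset.prod_eq_one fun i _ => Circle.norm_coe _

lemma torusChar_add_arg (n : Fin d → ℤ) (x y : Torus d L) :
    torusChar n (x + y) = torusChar n x * torusChar n y := by
  simp [torusChar_apply, ← Finset.prod_mul_distrib, AddCircle.toCircle_add, smul_add]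

lemma torusChar_single (z : Torus d L) (i : Fin d) :
    torusChar (Pi.single i 1) z = fourier 1 (z i) := by
  rw [torusChar_apply, Finset.prod_eq_single i]
  · rw [Pi.single_eq_same]
  · intro j _ hj
    rw [Pi.single_eq_of_ne hj, fourier_zero]
  · simp

/-- The star subalgebra generated by the characters. -/
def charSubalgebra (d : ℕ) (L : ℝ) : StarSubalgebra ℂ C(Torus d L, ℂ) where
  toSubalgebra := Algebra.adjoin ℂ (Set.range torusChar)
  star_mem' := by
    change Algebra.adjoin ℂ (Set.range torusChar) ≤
      star (Algebra.adjoin ℂ (Set.range torusChar))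
    refine Algebra.adjoin_le ?_
    rintro _ ⟨n, rfl⟩
    refine Algebra.subset_adjoin ⟨-n, ?_⟩
    ext1 x
    simp only [torusChar_neg, starRingEnd_apply, ContinuousMap.star_apply]

theorem charSubalgebra_coe :
    (charSubalgebra d L).toSubalgebra.toSubmodule = Submodule.span ℂ (Set.range torusChar) := by
  apply Algebra.adjoin_eq_span_of_subset
  refine .trans (fun x ↦ Submonoid.closure_induction (fun _ ↦ id) ⟨0, ?_⟩ ?_)
    Submodule.subset_span
  · exact torusChar_zero
  · rintro _ _ _ _ ⟨m, rfl⟩ ⟨n, rfl⟩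
    exact ⟨m + n, torusChar_add m n⟩

variable [hL : Fact (0 < L)]

/-- Points that differ in coordinate i are separated by the first harmonic in that coordinate;
Stone–Weierstrass then gives density of the characters. -/
theorem charSubalgebra_separatesPoints : (charSubalgebra d L).SeparatesPoints := by
  intro x y hxy
  rw [Ne, funext_iff, not_forall] at hxy
  obtain ⟨i, hi⟩ := hxy
  refine ⟨torusChar (Pi.single i 1), ⟨torusChar (Pi.single i 1),
    Algebra.subset_adjoin ⟨Pi.single i 1, rfl⟩, rfl⟩, fun h => hi ?_⟩
  rw [torusChar_single, torusChar_single, fourier_one, fourier_one] at h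
  exact AddCircle.injective_toCircle hL.out.ne' (Subtype.coe_injective h)

theorem span_torusChar_closure_eq_top :
    (Submodule.span ℂ (Set.range <| torusChar (d := d) (L := L))).topologicalClosure = ⊤ := by
  rw [← charSubalgebra_coe]
  exact congr_arg (Subalgebra.toSubmodule <| StarSubalgebra.toSubalgebra ·)
    (ContinuousMap.starSubalgebra_topologicalClosure_eq_top_of_separatesPoints _
      charSubalgebra_separatesPoints)

/-! ### Integrals over the torus -/

lemma volume_torus_univ :
    (volume : Measure (Torus d L)) Set.univ = ENNReal.ofReal (L ^ d) := by
  rw [volume_pi, Measure.pi_univ]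
  simp [AddCircle.measure_univ, ENNReal.ofReal_pow hL.out.le]

lemma volume_torus_real : (volume : Measure (Torus d L)).real Set.univ = L ^ d := by
  rw [measureReal_def, volume_torus_univ, ENNReal.toReal_ofReal (pow_pos hL.out d).le]

/-- For n ≠ 0, translation by half a period of the mode changes its sign. -/
lemma integral_fourier (n : ℤ) :
    ∫ x : AddCircle L, fourier n x = if n = 0 then (L : ℂ) else 0 := by
  split_ifs with h
  · subst h
    simp only [fourier_zero, integral_const, measureReal_def, AddCircle.measure_univ,
      ENNReal.toReal_ofReal hL.out.le]
    simp
  · exact integral_eq_zero_of_add_right_eq_neg (fourier_add_half_inv_index h hL.out)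

lemma integral_torusChar (n : Fin d → ℤ) :
    ∫ x : Torus d L, torusChar n x = if n = 0 then ((L ^ d : ℝ) : ℂ) else 0 := by
  simp only [torusChar_apply]
  rw [integral_fintype_prod_volume_eq_prod]
  simp only [integral_fourier]
  split_ifs with h
  · simp [h]
  · obtain ⟨i, hi⟩ := Function.ne_iff.mp h
    exact Finset.prod_eq_zero (Finset.mem_univ i) (if_neg hi)

/-! ### Parseval's identity -/

/-- The normalised characters as elements of `L²`. -/
def charLp (n : Fin d → ℤ) : Lp ℂ 2 (volume : Measure (Torus d L)) :=
  (((Real.sqrt (L ^ d))⁻¹ : ℝ) : ℂ) • ContinuousMap.toLp (E := ℂ) 2 volume ℂ (torusChar n)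

lemma orthonormal_charLp : Orthonormal ℂ (charLp (d := d) (L := L)) := by
  have hM : 0 < L ^ d := pow_pos hL.out d
  rw [orthonormal_iff_ite]
  intro m n
  simp only [charLp, inner_smul_left, inner_smul_right, ContinuousMap.inner_toLp,
    ← torusChar_neg]
  have : ∀ x : Torus d L, torusChar n x * torusChar (-m) x = torusChar (n + -m) x := fun x => by
    rw [torusChar_add]; rfl
  simp only [this, integral_torusChar, Complex.conj_ofReal]
  by_cases h : m = n
  · subst h
    simp only [add_neg_cancel, if_true]
    norm_cast
    have := Real.mul_self_sqrt hM.le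
    have h2 : Real.sqrt (L ^ d) ≠ 0 := (Real.sqrt_pos.2 hM).ne'
    field_simp
    nlinarith
  · have : n + -m ≠ 0 := fun h' => h (add_neg_eq_zero.1 h').symm
    simp [h, this]

lemma span_charLp_closure_eq_top :
    (Submodule.span ℂ (Set.range (charLp (d := d) (L := L)))).topologicalClosure = ⊤ := by
  have h1 : (Submodule.span ℂ (Set.range fun n =>
      ContinuousMap.toLp (E := ℂ) 2 (volume : Measure (Torus d L)) ℂ
        (torusChar n))).topologicalClosure = ⊤ := by
    simpa only [Submodule.map_span, ContinuousLinearMap.coe_coe, ← Set.range_comp,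
      Function.comp_def] using
      (ContinuousMap.toLp_denseRange ℂ (volume : Measure (Torus d L)) ℂ
        (by simp)).topologicalClosure_map_submodule span_torusChar_closure_eq_top
  rw [eq_top_iff, ← h1]
  apply Submodule.topologicalClosure_mono
  rw [Submodule.span_le]
  rintro _ ⟨n, rfl⟩
  have hs : (((Real.sqrt (L ^ d))⁻¹ : ℝ) : ℂ) ≠ 0 := by
    have := Real.sqrt_pos.2 (pow_pos hL.out d)
    exact_mod_cast (inv_pos.2 this).ne'
  have := Submodule.smul_mem (Submodule.span ℂ (Set.range (charLp (d := d) (L := L))))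
    ((((Real.sqrt (L ^ d))⁻¹ : ℝ) : ℂ))⁻¹ (Submodule.subset_span ⟨n, rfl⟩)
  rwa [charLp, smul_smul, inv_mul_cancel₀ hs, one_smul] at this

/-- The Fourier basis of `L²` of the torus. -/
def charBasis : HilbertBasis (Fin d → ℤ) ℂ (Lp ℂ 2 (volume : Measure (Torus d L))) :=
  HilbertBasis.mk orthonormal_charLp span_charLp_closure_eq_top.ge

/-- The (unnormalised) complex Fourier coefficient `∫ f χ_{-n}`. -/
def fourierInt (f : Torus d L → ℂ) (n : Fin d → ℤ) : ℂ := ∫ x, f x * torusChar (-n) x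

lemma inner_charLp (n : Fin d → ℤ) {f : Torus d L → ℂ} (hf : MemLp f 2) :
    inner ℂ (charLp n) (hf.toLp f) = (((Real.sqrt (L ^ d))⁻¹ : ℝ) : ℂ) * fourierInt f n := by
  rw [charLp, inner_smul_left, Complex.conj_ofReal, MeasureTheory.L2.inner_def, fourierInt]
  congr 1
  apply integral_congr_ae
  filter_upwards [hf.coeFn_toLp, ContinuousMap.coeFn_toLp (p := 2) (𝕜 := ℂ) volume
    (torusChar (L := L) n)] with x hx hx2
  rw [hx, hx2, torusChar_neg]
  simp [RCLike.inner_apply]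

/-- Parseval's identity for inner products. -/
theorem hasSum_parseval {f g : Torus d L → ℂ} (hf : MemLp f 2) (hg : MemLp g 2) :
    HasSum (fun n => ((L ^ d : ℝ) : ℂ)⁻¹ * (conj (fourierInt f n) * fourierInt g n))
      (∫ x, conj (f x) * g x) := by
  have h := (charBasis (d := d) (L := L)).hasSum_inner_mul_inner (hf.toLp f) (hg.toLp g)
  have hb : ⇑(charBasis (d := d) (L := L)) = charLp := HilbertBasis.coe_mk _ _
  have hM : 0 < L ^ d := pow_pos hL.out d
  rw [hb] at h
  have e : inner ℂ (hf.toLp f) (hg.toLp g) = ∫ x, conj (f x) * g x := by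
    rw [MeasureTheory.L2.inner_def]
    apply integral_congr_ae
    filter_upwards [hf.coeFn_toLp, hg.coeFn_toLp] with x hx hx2
    rw [hx, hx2, RCLike.inner_apply, mul_comm]
  rw [e] at h
  refine h.congr_fun fun n => ?_
  rw [← inner_conj_symm, inner_charLp, inner_charLp, map_mul, Complex.conj_ofReal]
  have : (((L ^ d : ℝ) : ℂ))⁻¹ =
      (((Real.sqrt (L ^ d))⁻¹ : ℝ) : ℂ) * (((Real.sqrt (L ^ d))⁻¹ : ℝ) : ℂ) := by
    rw [← Complex.ofReal_mul, ← Complex.ofReal_inv, ← mul_inv, Real.mul_self_sqrt hM.le]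
  rw [this]; ring

/-! ### Coordinate flips and even potentials -/

lemma measurePreserving_flip (i : Fin d) :
    MeasurePreserving (fun x : Torus d L => Function.update x i (-(x i))) volume volume := by
  have h : (fun x : Torus d L => Function.update x i (-(x i))) =
      fun x j => (if j = i then (fun y : AddCircle L => -y) else id) (x j) := by
    ext x j
    by_cases hj : j = i
    · subst hj; simp
    · simp [hj]
  rw [h]
  refine volume_preserving_pi (f := fun j => if j = i then (fun y : AddCircle L => -y) else id) ?_
  intro j
  by_cases hj : j = i
  · simp only [hj, if_true]; exact Measure.measurePreserving_neg _
  · simp only [hj, if_false]; exact MeasurePreserving.id _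

lemma integral_flip (i : Fin d) {f : Torus d L → ℂ} (hf : Continuous f) :
    ∫ x : Torus d L, f (Function.update x i (-(x i))) = ∫ x, f x := by
  have h := measurePreserving_flip (L := L) i
  conv_rhs => rw [← h.map_eq]
  rw [integral_map h.measurable.aemeasurable hf.aestronglyMeasurable]

lemma fourier_neg_arg (n : ℤ) (x : AddCircle L) : fourier n (-x) = conj (fourier n x) := by
  rw [← fourier_neg, fourier_apply, fourier_apply, smul_neg, neg_smul]

/-- The covering ℝ^d → torus is a product of open quotient maps, hence itself a quotient map. -/
lemma continuous_of_lift {W : Torus d L → ℝ}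
    (h : Continuous fun x : Fin d → ℝ => W fun i => (x i : AddCircle L)) : Continuous W := by
  have hq : IsOpenQuotientMap (Pi.map fun (_ : Fin d) (x : ℝ) => (x : AddCircle L)) :=
    IsOpenQuotientMap.piMap fun _ => QuotientAddGroup.isOpenQuotientMap_mk
  exact hq.isQuotientMap.continuous_iff.2 h

lemma IsPotential.cont {W : Torus d L → ℝ} (hW : IsPotential W) : Continuous W :=
  continuous_of_lift hW.contDiff.continuous

lemma IsPotential.neg {W : Torus d L → ℝ} (hW : IsPotential W) (x : Torus d L) :
    W (-x) = W x := by
  have key : ∀ s : Finset (Fin d), W (fun i => if i ∈ s then -(x i) else x i) = W x := by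
    intro s
    induction s using Finset.induction_on with
    | empty => simp
    | insert a s ha ih =>
      rw [← ih, ← hW.even a]
      congr 1
      ext i
      by_cases hi : i = a
      · subst hi; simp [ha]
      · simp [hi]
  have := key Finset.univ
  simpa [Pi.neg_def] using this

/-- Flipping one coordinate preserves W and conjugates that exponential factor, so the factor may be
averaged with its conjugate. Doing this in every coordinate identifies complex coefficients of W
with cosine coefficients. -/
lemma IsPotential.integral_cos_prod {W : Torus d L → ℝ} (hW : IsPotential W) (n : Fin d → ℤ)
    (s : Finset (Fin d)) :
    ∫ x : Torus d L, (W x : ℂ) *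
        ∏ i, (if i ∈ s then (((fourier (n i) (x i)).re : ℝ) : ℂ) else fourier (n i) (x i)) =
      ∫ x : Torus d L, (W x : ℂ) * torusChar n x := by
  have hWc := hW.cont
  induction s using Finset.induction_on with
  | empty => simp [torusChar_apply]
  | insert a s ha ih =>
    rw [← ih]
    set P : Torus d L → ℂ := fun x => ∏ i ∈ {a}ᶜ,
      (if i ∈ s then (((fourier (n i) (x i)).re : ℝ) : ℂ) else fourier (n i) (x i)) with hP
    have hPc : Continuous P := by
      refine continuous_finsetProd _ fun i _ => ?_
      split_ifs <;> fun_prop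
    have hPf : ∀ x, P (Function.update x a (-(x a))) = P x := by
      intro x
      refine Finset.prod_congr rfl fun i hi => ?_
      have : i ≠ a := by simpa using hi
      simp [this]
    have e1 : ∀ x : Torus d L, (W x : ℂ) *
        ∏ i, (if i ∈ s then (((fourier (n i) (x i)).re : ℝ) : ℂ) else fourier (n i) (x i)) =
        (W x : ℂ) * P x * fourier (n a) (x a) := by
      intro x
      rw [Fintype.prod_eq_mul_prod_compl a, if_neg ha]
      simp only [hP]; ring
    have e2 : ∀ x : Torus d L, (W x : ℂ) *
        ∏ i, (if i ∈ insert a s then (((fourier (n i) (x i)).re : ℝ) : ℂ)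
          else fourier (n i) (x i)) =
        2⁻¹ * ((W x : ℂ) * P x * fourier (n a) (x a)) +
          2⁻¹ * ((W x : ℂ) * P x * conj (fourier (n a) (x a))) := by
      intro x
      rw [Fintype.prod_eq_mul_prod_compl a, if_pos (Finset.mem_insert_self a s)]
      have : ∏ i ∈ {a}ᶜ, (if i ∈ insert a s then (((fourier (n i) (x i)).re : ℝ) : ℂ)
          else fourier (n i) (x i)) = P x := by
        refine Finset.prod_congr rfl fun i hi => ?_
        have : i ≠ a := by simpa using hi
        simp [this]
      rw [this, Complex.re_eq_add_conj]; ring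
    have c1 : Continuous fun x : Torus d L => (W x : ℂ) * P x * fourier (n a) (x a) := by fun_prop
    have c2 : Continuous fun x : Torus d L => (W x : ℂ) * P x * conj (fourier (n a) (x a)) := by
      fun_prop
    simp only [e1, e2]
    rw [integral_add
      ((c1.integrable_of_hasCompactSupport (HasCompactSupport.of_compactSpace _)).const_mul _)
      ((c2.integrable_of_hasCompactSupport (HasCompactSupport.of_compactSpace _)).const_mul _),
      integral_const_mul, integral_const_mul, ← integral_flip a c2]
    have : ∀ x : Torus d L, (W (Function.update x a (-(x a))) : ℂ) *
        P (Function.update x a (-(x a))) *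
          conj (fourier (n a) (Function.update x a (-(x a)) a)) =
        (W x : ℂ) * P x * fourier (n a) (x a) := by
      intro x
      rw [hW.even, hPf, Function.update_self, fourier_neg_arg, Complex.conj_conj]
    simp only [this]; ring

/-- The mode in `ℕ^d` of coordinatewise absolute values. -/
def absMode (n : Fin d → ℤ) : Fin d → ℕ := fun i => (n i).natAbs

lemma trig1_natCast (n : ℕ) (x : AddCircle L) : trig1 (n : ℤ) x = (fourier (n : ℤ) x).re := by
  unfold trig1
  rcases Nat.eq_zero_or_pos n with h | h
  · subst h; simp
  · rw [if_pos (by exact_mod_cast h)]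

lemma fourier_re_natAbs (n : ℤ) (x : AddCircle L) :
    (fourier (n.natAbs : ℤ) x).re = (fourier n x).re := by
  rcases Int.natAbs_eq n with h | h
  · rw [← h]
  · conv_rhs => rw [h, fourier_neg, Complex.conj_re]

lemma Theta_pos (k : Fin d → ℤ) : 0 < Theta k :=
  Finset.prod_pos fun i _ => Real.sqrt_pos.2 (by split_ifs <;> norm_num)

lemma normConst_pos (k : Fin d → ℤ) : 0 < normConst L k :=
  div_pos (Theta_pos k) (Real.rpow_pos_of_pos hL.out _)

/-- The complex Fourier coefficients of the potential. -/
def symbol (W : Torus d L → ℝ) (n : Fin d → ℤ) : ℝ :=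
  coeff W (natMode (absMode n)) / normConst L (natMode (absMode n))

lemma IsPotential.fourierInt_eq {W : Torus d L → ℝ} (hW : IsPotential W) (n : Fin d → ℤ) :
    fourierInt (fun x => (W x : ℂ)) n = symbol W n := by
  have h := hW.integral_cos_prod (-n) Finset.univ
  rw [fourierInt, ← h, symbol, coeff, ← integral_div, ← integral_complex_ofReal]
  refine integral_congr_ae (ae_of_all _ fun x => ?_)
  simp only [Finset.mem_univ, if_true, basisFn, natMode, absMode, trig1_natCast,
    fourier_re_natAbs, Pi.neg_apply, fourier_neg, Complex.conj_re]
  have := (normConst_pos (L := L) (natMode (absMode n))).ne'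
  rw [← Complex.ofReal_prod, ← Complex.ofReal_mul]
  congr 1
  field_simp

/-- The basis function contains a sine in coordinate i, so it is odd there while W is even. -/
lemma IsPotential.coeff_eq_zero {W : Torus d L → ℝ} (hW : IsPotential W) (k : Fin d → ℤ)
    (i : Fin d) (hi : k i < 0) : coeff W k = 0 := by
  have hb : ∀ x : Torus d L, basisFn k (Function.update x i (-(x i))) = -basisFn k x := by
    intro x
    unfold basisFn
    rw [Fintype.prod_eq_mul_prod_compl i, Fintype.prod_eq_mul_prod_compl i]
    have h1 : ∏ j ∈ {i}ᶜ, trig1 (k j) (Function.update x i (-(x i)) j) =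
        ∏ j ∈ {i}ᶜ, trig1 (k j) (x j) := by
      refine Finset.prod_congr rfl fun j hj => ?_
      have : j ≠ i := by simpa using hj
      simp [this]
    have h2 : trig1 (k i) (-(x i)) = -trig1 (k i) (x i) := by
      unfold trig1
      rw [if_neg (by omega), if_neg (by omega), if_neg (by omega), if_neg (by omega),
        fourier_neg_arg, Complex.conj_im]
    rw [h1, Function.update_self, h2]; ring
  have hc : Continuous (basisFn (L := L) k) := by
    unfold basisFn
    refine continuous_const.mul (continuous_finsetProd _ fun j _ => ?_)
    unfold trig1
    split_ifs <;> fun_prop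
  have h := measurePreserving_flip (L := L) i
  have h3 : coeff W k = -coeff W k := by
    conv_lhs => rw [coeff, ← h.map_eq]
    rw [integral_map h.measurable.aemeasurable 
      (show Continuous fun x => W x * basisFn k x from hW.cont.mul hc).aestronglyMeasurable, coeff,
      ← integral_neg]
    congr 1
    ext x
    rw [hW.even, hb]; ring
  linarith

/-! ### Convolution with the potential -/

/-- The convolution `W * f`. -/
def conv (W f : Torus d L → ℝ) (x : Torus d L) : ℝ := ∫ y, W (x - y) * f y

lemma exists_bound_of_continuous {W : Torus d L → ℝ} (hW : Continuous W) :
    ∃ C, 0 < C ∧ ∀ x, |W x| ≤ C := by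
  obtain ⟨C, hC⟩ := isCompact_univ.exists_bound_of_continuousOn hW.continuousOn
  -- A strictly positive bound, since it is divided by in `minimisers_tendsto`.
  exact ⟨max C 1, by positivity, fun x => (hC x trivial).trans (le_max_left _ _)⟩

lemma Continuous.integrable_torus {E : Type*} [NormedAddCommGroup E] {f : Torus d L → E}
    (hf : Continuous f) : Integrable f :=
  hf.integrable_of_hasCompactSupport (HasCompactSupport.of_compactSpace _)

lemma integrable_kernel {W f : Torus d L → ℝ} (hW : Continuous W) (hf : Integrable f)
    (x : Torus d L) : Integrable fun y => W (x - y) * f y := by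
  obtain ⟨C, -, hC⟩ := exists_bound_of_continuous hW
  exact hf.bdd_mul (c := C) (by fun_prop : Continuous fun y => W (x - y)).aestronglyMeasurable
    (ae_of_all _ fun y => hC _)

lemma continuous_conv {W f : Torus d L → ℝ} (hW : Continuous W) (hf : Integrable f) :
    Continuous (conv W f) := by
  obtain ⟨C, -, hC⟩ := exists_bound_of_continuous hW
  refine continuous_of_dominated (bound := fun y => C * |f y|)
    (fun x => (integrable_kernel hW hf x).aestronglyMeasurable) ?_ (hf.abs.const_mul C) ?_
  · intro x
    refine ae_of_all _ fun y => ?_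
    rw [norm_mul]
    exact mul_le_mul_of_nonneg_right (hC _) (norm_nonneg _)
  · exact ae_of_all _ fun y => by fun_prop

lemma abs_conv_le {W f : Torus d L → ℝ} {C : ℝ} (hC : ∀ x, |W x| ≤ C) (hf : Integrable f)
    (x : Torus d L) : |conv W f x| ≤ C * ∫ y, |f y| := by
  rw [conv, ← integral_const_mul, ← Real.norm_eq_abs]
  refine norm_integral_le_of_norm_le (hf.abs.const_mul C) (ae_of_all _ fun y => ?_)
  rw [norm_mul]
  exact mul_le_mul_of_nonneg_right (hC _) (norm_nonneg _)

lemma integrable_kernel_prod {W f g : Torus d L → ℝ} (hW : Continuous W) (hf : Integrable f)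
    (hg : Integrable g) :
    Integrable (fun p : Torus d L × Torus d L => W (p.1 - p.2) * (g p.1 * f p.2))
      (volume.prod volume) := by
  obtain ⟨C, -, hC⟩ := exists_bound_of_continuous hW
  exact (hg.mul_prod hf).bdd_mul (c := C)
    (by fun_prop : Continuous fun p : Torus d L × Torus d L => W (p.1 - p.2)).aestronglyMeasurable
    (ae_of_all _ fun y => hC _)

/-- Fubini together with W(-x) = W(x). -/
lemma integral_mul_conv_comm {W f g : Torus d L → ℝ} (hW : IsPotential W) (hf : Integrable f)
    (hg : Integrable g) : ∫ x, g x * conv W f x = ∫ x, f x * conv W g x := by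
  have h := integral_integral_swap (f := fun x y => W (x - y) * (g x * f y))
    (integrable_kernel_prod hW.cont hf hg)
  have e1 : ∀ x, g x * conv W f x = ∫ y, W (x - y) * (g x * f y) := fun x => by
    rw [conv, ← integral_const_mul]
    congr 1; ext y; ring
  have e2 : ∀ x, f x * conv W g x = ∫ y, W (y - x) * (g y * f x) := fun x => by
    rw [conv, ← integral_const_mul]
    congr 1; ext y
    rw [← hW.neg (x - y), neg_sub]; ring
  simp only [e1, e2]
  exact h

lemma conv_add {W f g : Torus d L → ℝ} (hW : Continuous W) (hf : Integrable f)
    (hg : Integrable g) (x : Torus d L) :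
    conv W (fun y => f y + g y) x = conv W f x + conv W g x := by
  unfold conv
  rw [← integral_add (integrable_kernel hW hf x) (integrable_kernel hW hg x)]
  congr 1; ext y; ring

lemma conv_const_mul (W f : Torus d L → ℝ) (c : ℝ) (x : Torus d L) :
    conv W (fun y => c * f y) x = c * conv W f x := by
  unfold conv
  rw [← integral_const_mul]
  congr 1; ext y; ring

lemma conv_const {W : Torus d L → ℝ} (hW : IsPotential W) (c : ℝ) (x : Torus d L) :
    conv W (fun _ => c) x = 0 := by
  unfold conv
  have : ∀ y, W (x - y) = W (y - x) := fun y => by rw [← hW.neg (x - y), neg_sub]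
  simp only [this]
  rw [integral_mul_const, integral_sub_right_eq_self W x, hW.mean_zero, zero_mul]

lemma fourierInt_conv {W f : Torus d L → ℝ} (hW : IsPotential W) (hf : Integrable f)
    (n : Fin d → ℤ) :
    fourierInt (fun x => (conv W f x : ℂ)) n = symbol W n * fourierInt (fun x => (f x : ℂ)) n := by
  have hWc := hW.cont
  have hi : Integrable (fun p : Torus d L × Torus d L =>
      ((W (p.1 - p.2) * (1 * f p.2) : ℝ) : ℂ) * torusChar (-n) p.1) (volume.prod volume) := by
    refine (integrable_kernel_prod hWc hf (integrable_const 1)).ofReal.mul_bdd (c := 1)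
      (by fun_prop : Continuous fun p : Torus d L × Torus d L =>
        torusChar (-n) p.1).aestronglyMeasurable (ae_of_all _ fun p => (norm_torusChar _ _).le)
  have h := integral_integral_swap
    (f := fun x y => ((W (x - y) * (1 * f y) : ℝ) : ℂ) * torusChar (-n) x) hi
  have e1 : ∀ x, (conv W f x : ℂ) * torusChar (-n) x =
      ∫ y, ((W (x - y) * (1 * f y) : ℝ) : ℂ) * torusChar (-n) x := fun x => by
    rw [integral_mul_const, integral_complex_ofReal, conv]
    simp
  have e2 : ∀ y, ∫ x, ((W (x - y) * (1 * f y) : ℝ) : ℂ) * torusChar (-n) x =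
      symbol W n * ((f y : ℂ) * torusChar (-n) y) := fun y => by
    rw [← hW.fourierInt_eq, fourierInt, ← integral_mul_const,
      ← integral_sub_right_eq_self (fun x => (W x : ℂ) * torusChar (-n) x *
        ((f y : ℂ) * torusChar (-n) y)) y]
    congr 1; ext x
    have : torusChar (-n) x = torusChar (-n) (x - y) * torusChar (-n) y := by
      rw [← torusChar_add_arg, sub_add_cancel]
    rw [this]; push_cast; ring
  unfold fourierInt
  simp only [e1]
  rw [h]
  simp only [e2]
  rw [integral_const_mul]

lemma memLp_of_continuous {E : Type*} [NormedAddCommGroup E] {f : Torus d L → E}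
    (hf : Continuous f) (p : ℝ≥0∞) : MemLp f p := by
  obtain ⟨C, hC⟩ := isCompact_univ.exists_bound_of_continuousOn hf.continuousOn
  exact MemLp.of_bound hf.aestronglyMeasurable C (ae_of_all _ fun x => hC x trivial)

/-- The interaction energy in Fourier variables. -/
theorem hasSum_interaction {W f : Torus d L → ℝ} (hW : IsPotential W) (hf : MemLp f 2) :
    HasSum (fun n => flatDensity d L * (symbol W n * ‖fourierInt (fun x => (f x : ℂ)) n‖ ^ 2))
      (∫ x, f x * conv W f x) := by
  have hi : Integrable f := hf.integrable (by norm_num)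
  have h := hasSum_parseval hf.ofReal
    (memLp_of_continuous (Complex.continuous_ofReal.comp (continuous_conv hW.cont hi)) 2)
  have h2 := Complex.hasSum_re h
  simp only [Function.comp_def, RCLike.conj_ofReal] at h2
  have e : (∫ x, (f x : ℂ) * (conv W f x : ℂ)).re = ∫ x, f x * conv W f x := by
    rw [← Complex.ofReal_re (∫ x, f x * conv W f x), ← integral_complex_ofReal]
    push_cast; rfl
  refine (show HasSum _ (∫ x, f x * conv W f x) by rw [← e]; exact h2).congr_fun fun n => ?_
  rw [fourierInt_conv hW hi, flatDensity, ← Complex.ofReal_inv, Complex.re_ofReal_mul]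
  congr 1
  have h3 := Complex.conj_mul' (fourierInt (fun x => (f x : ℂ)) n)
  rw [mul_left_comm]
  refine Eq.trans ?_ (congrArg (fun z => (symbol W n * z : ℂ).re) h3).symm
  rw [← Complex.ofReal_pow, ← Complex.ofReal_mul, Complex.ofReal_re]

/-! ### Real trigonometric projections -/

lemma flatDensity_pos (d : ℕ) (L : ℝ) [hL : Fact (0 < L)] : 0 < flatDensity d L :=
  inv_pos.2 (pow_pos hL.out d)

/-- The Fourier partial sum of a real function over a finite set of modes. -/
def trigPoly (S : Finset (Fin d → ℤ)) (f : Torus d L → ℝ) : C(Torus d L, ℂ) :=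
  ∑ n ∈ S, ((flatDensity d L : ℂ) * fourierInt (fun x => (f x : ℂ)) n) • torusChar n

/-- The real part of the Fourier partial sum. -/
def trigProj (S : Finset (Fin d → ℤ)) (f : Torus d L → ℝ) (x : Torus d L) : ℝ :=
  (trigPoly S f x).re

lemma trigPoly_apply (S : Finset (Fin d → ℤ)) (f : Torus d L → ℝ) (x : Torus d L) :
    trigPoly S f x =
      ∑ n ∈ S, (flatDensity d L : ℂ) * fourierInt (fun x => (f x : ℂ)) n * torusChar n x := by
  simp [trigPoly, ContinuousMap.sum_apply]

lemma continuous_trigProj (S : Finset (Fin d → ℤ)) (f : Torus d L → ℝ) :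
    Continuous (trigProj S f) :=
  Complex.continuous_re.comp (trigPoly S f).continuous

lemma fourierInt_neg (f : Torus d L → ℝ) (n : Fin d → ℤ) :
    fourierInt (fun x => (f x : ℂ)) (-n) = conj (fourierInt (fun x => (f x : ℂ)) n) := by
  rw [fourierInt, fourierInt, ← integral_conj]
  congr 1; ext x
  rw [map_mul, Complex.conj_ofReal, torusChar_neg, torusChar_neg]

/-- For a real function the coefficients at n and -n are conjugate, so a partial sum over a
symmetric set of modes is real. -/
lemma ofReal_trigProj {S : Finset (Fin d → ℤ)} (hS : ∀ n ∈ S, -n ∈ S) (f : Torus d L → ℝ)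
    (x : Torus d L) : (trigProj S f x : ℂ) = trigPoly S f x := by
  rw [trigProj, ← Complex.conj_eq_iff_re, trigPoly_apply, map_sum]
  refine Finset.sum_nbij' (fun n => -n) (fun n => -n) hS hS (by simp) (by simp) fun n _ => ?_
  rw [map_mul, map_mul, Complex.conj_ofReal, torusChar_neg, fourierInt_neg]

lemma trigPoly_mem_span (S : Finset (Fin d → ℤ)) (f : Torus d L → ℝ) :
    trigPoly S f ∈ Submodule.span ℂ (torusChar '' (S : Set (Fin d → ℤ))) :=
  Submodule.sum_mem _ fun n hn =>
    Submodule.smul_mem _ _ (Submodule.subset_span ⟨n, by simpa using hn, rfl⟩)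

lemma integrable_continuousMap_mul (h : C(Torus d L, ℂ)) {f : Torus d L → ℂ}
    (hf : Integrable f) : Integrable fun x => h x * f x :=
  hf.bdd_mul (c := ‖h‖) h.continuous.aestronglyMeasurable (ae_of_all _ h.norm_coe_le_norm)

lemma integral_torusChar_mul_trigPoly (S : Finset (Fin d → ℤ)) (f : Torus d L → ℝ)
    (m : Fin d → ℤ) :
    ∫ x, torusChar m x * trigPoly S f x =
      if -m ∈ S then fourierInt (fun x => (f x : ℂ)) (-m) else 0 := by
  have hM : ((L ^ d : ℝ) : ℂ) ≠ 0 := by exact_mod_cast (pow_pos hL.out d).ne'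
  have e : ∀ x, torusChar m x * trigPoly S f x = ∑ n ∈ S,
      (flatDensity d L : ℂ) * fourierInt (fun x => (f x : ℂ)) n * torusChar (m + n) x := fun x => by
    rw [trigPoly_apply, Finset.mul_sum]
    refine Finset.sum_congr rfl fun n _ => ?_
    rw [torusChar_add, ContinuousMap.mul_apply]; ring
  simp only [e]
  rw [integral_finsetSum _ fun n _ =>
    (Continuous.integrable_torus (torusChar (m + n)).continuous).const_mul _]
  simp only [integral_const_mul, integral_torusChar]
  have e2 : ∀ n : Fin d → ℤ, m + n = 0 ↔ n = -m := fun n => by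
    rw [add_comm]; exact eq_neg_iff_add_eq_zero.symm
  simp only [e2, mul_ite, mul_zero, Finset.sum_ite_eq']
  split_ifs
  · rw [flatDensity]; push_cast at hM ⊢; field_simp
  · rfl

/-- A trigonometric polynomial only sees the corresponding modes of a function. -/
lemma integral_mul_trigPoly {S : Finset (Fin d → ℤ)} {T : Set (Fin d → ℤ)} {f : Torus d L → ℝ}
    (hf : Integrable f) {h : C(Torus d L, ℂ)} (hh : h ∈ Submodule.span ℂ (torusChar '' T))
    (hT : ∀ m ∈ T, -m ∉ S → fourierInt (fun x => (f x : ℂ)) (-m) = 0) :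
    ∫ x, h x * (f x : ℂ) = ∫ x, h x * trigPoly S f x := by
  have i1 : Integrable fun x => (f x : ℂ) := hf.ofReal
  have i2 : Integrable (trigPoly S f) := Continuous.integrable_torus (trigPoly S f).continuous
  induction hh using Submodule.span_induction with
  | mem h hh =>
    obtain ⟨m, hm, rfl⟩ := hh
    rw [integral_torusChar_mul_trigPoly]
    have : ∫ x, torusChar m x * (f x : ℂ) = fourierInt (fun x => (f x : ℂ)) (-m) := by
      rw [fourierInt, neg_neg]; congr 1; ext x; ring
    rw [this]
    split_ifs with hS
    · rfl
    · exact hT m hm hS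
  | zero => simp
  | add a b _ _ ha hb =>
    simp only [ContinuousMap.add_apply, add_mul]
    rw [integral_add (integrable_continuousMap_mul a i1)
      (integrable_continuousMap_mul b i1), integral_add (integrable_continuousMap_mul a i2)
      (integrable_continuousMap_mul b i2), ha, hb]
  | smul c a _ ha =>
    simp only [ContinuousMap.smul_apply, smul_eq_mul, mul_assoc]
    rw [integral_const_mul, integral_const_mul, ha]

lemma integral_eq_zero_of_mem_span {T : Set (Fin d → ℤ)} {h : C(Torus d L, ℂ)}
    (hh : h ∈ Submodule.span ℂ (torusChar '' T)) (hT : (0 : Fin d → ℤ) ∉ T) : ∫ x, h x = 0 := by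
  have h1 := integral_mul_trigPoly (S := ∅) (f := fun _ => 1) (integrable_const 1) hh
    (fun m hm _ => by
      have : m ≠ 0 := fun h0 => hT (h0 ▸ hm)
      simp [fourierInt, integral_torusChar, this])
  simpa [trigPoly] using h1

/-- Frequencies add under multiplication; this locates the spectra of u² and u³. -/
lemma mul_mem_span_torusChar {A B C : Set (Fin d → ℤ)} (hABC : ∀ a ∈ A, ∀ b ∈ B, a + b ∈ C)
    {f g : C(Torus d L, ℂ)} (hf : f ∈ Submodule.span ℂ (torusChar '' A))
    (hg : g ∈ Submodule.span ℂ (torusChar '' B)) :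
    f * g ∈ Submodule.span ℂ (torusChar '' C) := by
  have h := Submodule.mul_mem_mul hf hg
  rw [Submodule.span_mul_span] at h
  refine Submodule.span_mono ?_ h
  rintro _ ⟨_, ⟨a, ha, rfl⟩, _, ⟨b, hb, rfl⟩, rfl⟩
  exact ⟨a + b, hABC a ha b hb, torusChar_add a b⟩

lemma integral_trigProj_sq {S : Finset (Fin d → ℤ)} (hS : ∀ n ∈ S, -n ∈ S) (f : Torus d L → ℝ) :
    ∫ x, trigProj S f x ^ 2 =
      ∑ n ∈ S, flatDensity d L * ‖fourierInt (fun x => (f x : ℂ)) n‖ ^ 2 := by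
  apply Complex.ofReal_injective
  rw [← integral_complex_ofReal]
  have e : ∀ x, ((trigProj S f x ^ 2 : ℝ) : ℂ) = ∑ n ∈ S,
      (flatDensity d L : ℂ) * fourierInt (fun x => (f x : ℂ)) n *
        (torusChar n x * trigPoly S f x) := fun x => by
    rw [Complex.ofReal_pow, ofReal_trigProj hS, sq]
    conv_lhs => rw [trigPoly_apply, Finset.sum_mul]
    refine Finset.sum_congr rfl fun n _ => ?_
    rw [← trigPoly_apply]; ring
  simp only [e]
  rw [integral_finsetSum _ fun n _ =>
    (Continuous.integrable_torus (by fun_prop : Continuous fun x => torusChar n x *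
      trigPoly S f x)).const_mul _]
  push_cast
  refine Finset.sum_congr rfl fun n hn => ?_
  rw [integral_const_mul, integral_torusChar_mul_trigPoly, if_pos (hS n hn), fourierInt_neg,
    mul_assoc, Complex.mul_conj']

lemma trigPoly_union {S T : Finset (Fin d → ℤ)} (h : Disjoint S T) (f : Torus d L → ℝ) :
    trigPoly (S ∪ T) f = trigPoly S f + trigPoly T f := Finset.sum_union h

/-! ### The modes of `k` and of its harmonics -/

/-- The modes `σ(k)`. -/
def modes (k : Fin d → ℕ) : Finset (Fin d → ℤ) :=
  Fintype.piFinset fun i => {(k i : ℤ), -(k i : ℤ)}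

/-- The modes `σ(j)` with `j ∈ P₂(k)`. -/
def modes2 (k : Fin d → ℕ) : Finset (Fin d → ℤ) :=
  (Fintype.piFinset fun i => {0, 2 * (k i : ℤ), -(2 * (k i : ℤ))}).erase 0

/-- The modes `σ(l)` with `l ∈ P₃(k)`. -/
def modes3 (k : Fin d → ℕ) : Finset (Fin d → ℤ) :=
  (Fintype.piFinset fun i => {(k i : ℤ), -(k i : ℤ), 3 * (k i : ℤ), -(3 * (k i : ℤ))}) \ modes k

lemma mem_modes {k : Fin d → ℕ} {n : Fin d → ℤ} :
    n ∈ modes k ↔ ∀ i, n i = k i ∨ n i = -(k i : ℤ) := by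
  simp [modes, Fintype.mem_piFinset]

lemma mem_modes2 {k : Fin d → ℕ} {n : Fin d → ℤ} :
    n ∈ modes2 k ↔ n ≠ 0 ∧ ∀ i, n i = 0 ∨ n i = 2 * k i ∨ n i = -(2 * (k i : ℤ)) := by
  simp [modes2, Fintype.mem_piFinset]

lemma mem_modes3 {k : Fin d → ℕ} {n : Fin d → ℤ} :
    n ∈ modes3 k ↔ (∀ i, n i = k i ∨ n i = -(k i : ℤ) ∨ n i = 3 * k i ∨ n i = -(3 * (k i : ℤ))) ∧
      n ∉ modes k := by
  simp [modes3, Fintype.mem_piFinset]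

lemma neg_mem_modes {k : Fin d → ℕ} {n : Fin d → ℤ} (h : n ∈ modes k) : -n ∈ modes k := by
  rw [mem_modes] at h ⊢
  intro i
  have := h i
  simp only [Pi.neg_apply]
  omega

lemma neg_mem_modes2 {k : Fin d → ℕ} {n : Fin d → ℤ} (h : n ∈ modes2 k) : -n ∈ modes2 k := by
  rw [mem_modes2] at h ⊢
  refine ⟨neg_ne_zero.2 h.1, fun i => ?_⟩
  have := h.2 i
  simp only [Pi.neg_apply]
  omega

lemma neg_mem_modes3 {k : Fin d → ℕ} {n : Fin d → ℤ} (h : n ∈ modes3 k) : -n ∈ modes3 k := by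
  rw [mem_modes3] at h ⊢
  refine ⟨fun i => ?_, fun h' => h.2 (by simpa using neg_mem_modes h')⟩
  have := h.1 i
  simp only [Pi.neg_apply]
  omega

lemma exists_pos_of_ne_zero {k : Fin d → ℕ} (hk : k ≠ 0) : ∃ i, 0 < k i := by
  obtain ⟨i, hi⟩ := Function.ne_iff.1 hk
  exact ⟨i, Nat.pos_of_ne_zero hi⟩

lemma disjoint_modes_modes2 {k : Fin d → ℕ} (hk : k ≠ 0) : Disjoint (modes k) (modes2 k) := by
  obtain ⟨i, hi⟩ := exists_pos_of_ne_zero hk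
  rw [Finset.disjoint_left]
  intro n h1 h2
  have h1 := mem_modes.1 h1 i
  have h2 := (mem_modes2.1 h2).2 i
  omega

lemma disjoint_modes_modes3 (k : Fin d → ℕ) : Disjoint (modes k) (modes3 k) :=
  Finset.disjoint_sdiff

lemma disjoint_modes2_modes3 {k : Fin d → ℕ} (hk : k ≠ 0) : Disjoint (modes2 k) (modes3 k) := by
  obtain ⟨i, hi⟩ := exists_pos_of_ne_zero hk
  rw [Finset.disjoint_left]
  intro n h1 h2
  have h1 := (mem_modes2.1 h1).2 i
  have h2 := (mem_modes3.1 h2).1 i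
  omega

lemma zero_notMem_modes {k : Fin d → ℕ} (hk : k ≠ 0) : (0 : Fin d → ℤ) ∉ modes k := by
  obtain ⟨i, hi⟩ := exists_pos_of_ne_zero hk
  intro h
  have := mem_modes.1 h i
  simp at this
  omega

lemma Theta_sq (k : Fin d → ℤ) : Theta k ^ 2 = ∏ i, (2 - if k i = 0 then 1 else 0 : ℝ) := by
  rw [Theta, ← Finset.prod_pow]
  refine Finset.prod_congr rfl fun i _ => Real.sq_sqrt ?_
  split_ifs <;> norm_num

lemma card_modes (k : Fin d → ℕ) : ((modes k).card : ℝ) = Theta (natMode k) ^ 2 := by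
  rw [modes, Fintype.card_piFinset, Theta_sq]
  push_cast
  refine Finset.prod_congr rfl fun i _ => ?_
  by_cases h : k i = 0
  · simp [h, natMode]; norm_num
  · rw [Finset.card_pair (by omega)]
    simp [h, natMode]

lemma two_le_Theta_sq {k : Fin d → ℕ} (hk : k ≠ 0) : 2 ≤ Theta (natMode k) ^ 2 := by
  obtain ⟨i, hi⟩ := exists_pos_of_ne_zero hk
  rw [Theta_sq, Fintype.prod_eq_mul_prod_compl i]
  have h1 : (1 : ℝ) ≤ ∏ j ∈ {i}ᶜ, (2 - if natMode k j = 0 then 1 else 0 : ℝ) :=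
    Finset.one_le_prod fun j _ => by split_ifs <;> norm_num
  have h2 : ¬ natMode k i = 0 := by simp [natMode]; omega
  rw [if_neg h2]
  linarith

/-- The integral identities satisfied by the projections of a mean-zero function onto the modes
of `k` and of its second and third harmonics. -/
lemma integral_projections {k : Fin d → ℕ} (hk : k ≠ 0) {f : Torus d L → ℝ} (hf : Integrable f)
    (hf0 : ∫ x, f x = 0) :
    (∫ x, trigProj (modes k) f x * f x = ∫ x, trigProj (modes k) f x ^ 2) ∧
    (∫ x, trigProj (modes k) f x ^ 3 = 0) ∧
    (∫ x, trigProj (modes k) f x ^ 2 * f x =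
      ∫ x, trigProj (modes k) f x ^ 2 * trigProj (modes2 k) f x) ∧
    (∫ x, trigProj (modes k) f x ^ 3 * f x =
      ∫ x, trigProj (modes k) f x ^ 3 * (trigProj (modes k) f x + trigProj (modes3 k) f x)) := by
  have hu := fun x => ofReal_trigProj (fun n => neg_mem_modes (k := k) (n := n)) f x
  have h2 := fun x => ofReal_trigProj (fun n => neg_mem_modes2 (k := k) (n := n)) f x
  have h3 := fun x => ofReal_trigProj (fun n => neg_mem_modes3 (k := k) (n := n)) f x
  obtain ⟨i, hi⟩ := exists_pos_of_ne_zero hk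
  set u := trigPoly (modes k) f
  have hus := trigPoly_mem_span (modes k) f
  have huus : u * u ∈ Submodule.span ℂ (torusChar ''
      {m : Fin d → ℤ | ∀ i, m i = 0 ∨ m i = 2 * k i ∨ m i = -(2 * (k i : ℤ))}) := by
    refine mul_mem_span_torusChar ?_ hus hus
    intro a ha b hb i
    have ha := mem_modes.1 (Finset.mem_coe.1 ha) i
    have hb := mem_modes.1 (Finset.mem_coe.1 hb) i
    simp only [Pi.add_apply]
    omega
  have huuus : u * u * u ∈ Submodule.span ℂ (torusChar ''
      {m : Fin d → ℤ | ∀ i, m i = k i ∨ m i = -(k i : ℤ) ∨ m i = 3 * k i ∨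
        m i = -(3 * (k i : ℤ))}) := by
    refine mul_mem_span_torusChar ?_ huus hus
    intro a ha b hb i
    have ha := ha i
    have hb := mem_modes.1 (Finset.mem_coe.1 hb) i
    simp only [Pi.add_apply]
    omega
  -- The frequency 0 occurs in u² but is excluded from `modes2 k`; this is where the vanishing mean
  -- of f enters.
  have hz : fourierInt (fun x => (f x : ℂ)) 0 = 0 := by
    rw [fourierInt]
    simp only [neg_zero, torusChar_zero, ContinuousMap.one_apply, mul_one]
    rw [integral_complex_ofReal, hf0, Complex.ofReal_zero]
  refine ⟨?_, ?_, ?_, ?_⟩ <;> apply Complex.ofReal_injective <;>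
    simp only [← integral_complex_ofReal, Complex.ofReal_mul, Complex.ofReal_pow,
      Complex.ofReal_add, Complex.ofReal_zero, hu, h2, h3]
  · simp only [sq]
    exact integral_mul_trigPoly hf hus fun m hm hm' => absurd (neg_mem_modes hm) hm'
  · rw [← integral_eq_zero_of_mem_span huuus]
    · congr 1; ext x; simp only [ContinuousMap.mul_apply]; ring
    -- Each coordinate of a frequency of u³ is an odd multiple of k i, and some k i is positive, so
    -- the frequency 0 is absent.
    · intro h
      have := h i
      simp at this
      omega
  · have e : ∀ x, u x ^ 2 = (u * u) x := fun x => sq (u x)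
    simp only [e]
    refine integral_mul_trigPoly hf huus fun m hm hm' => ?_
    by_cases hm0 : m = 0
    · rw [hm0, neg_zero, hz]
    · refine absurd (neg_mem_modes2 (mem_modes2.2 ⟨hm0, hm⟩)) hm'
  · have e : ∀ x, u x ^ 3 = (u * u * u) x := fun x => by
      simp only [ContinuousMap.mul_apply]; ring
    have e2 : ∀ x, u x + trigPoly (modes3 k) f x = trigPoly (modes k ∪ modes3 k) f x := fun x => by
      rw [trigPoly_union (disjoint_modes_modes3 k)]; rfl
    simp only [e, e2]
    refine integral_mul_trigPoly hf huuus fun m hm hm' => ?_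
    refine absurd ?_ hm'
    rw [Finset.mem_union]
    by_cases h : m ∈ modes k
    · exact Or.inl (neg_mem_modes h)
    · exact Or.inr (neg_mem_modes3 (mem_modes3.2 ⟨hm, h⟩))

lemma norm_fourierInt_le (f : Torus d L → ℝ) (n : Fin d → ℤ) :
    ‖fourierInt (fun x => (f x : ℂ)) n‖ ≤ ∫ x, |f x| := by
  refine (norm_integral_le_integral_norm _).trans (le_of_eq ?_)
  congr 1; ext x
  rw [norm_mul, norm_torusChar, mul_one, Complex.norm_real, Real.norm_eq_abs]

lemma fourierInt_add_const {f : Torus d L → ℝ} (hf : Integrable f) (c : ℝ) {n : Fin d → ℤ}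
    (hn : n ≠ 0) : fourierInt (fun x => ((f x + c : ℝ) : ℂ)) n = fourierInt (fun x => (f x : ℂ)) n := by
  have hi : Integrable fun x => (f x : ℂ) * torusChar (-n) x :=
    (integrable_continuousMap_mul (torusChar (-n)) hf.ofReal).congr
      (ae_of_all _ fun x => mul_comm _ _)
  simp only [fourierInt, Complex.ofReal_add, add_mul]
  rw [integral_add hi ((Continuous.integrable_torus (torusChar (-n)).continuous).const_mul _),
    integral_const_mul, integral_torusChar, if_neg (neg_ne_zero.2 hn)]
  simp

/-- The projection onto the modes of `k` of a perturbation of the flat density that keeps it a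
probability density is bounded. -/
lemma abs_trigProj_modes_le {k : Fin d → ℕ} (hk : k ≠ 0) {f : Torus d L → ℝ} (hf : Integrable f)
    (hf0 : ∫ x, f x = 0) (hfr : ∀ᵐ x, 0 ≤ f x + flatDensity d L) (x : Torus d L) :
    |trigProj (modes k) f x| ≤ flatDensity d L * Theta (natMode k) ^ 2 := by
  have hr := flatDensity_pos d L
  have h1 : ∫ x, |f x + flatDensity d L| = 1 := by
    rw [integral_congr_ae (g := fun x => f x + flatDensity d L)
      (hfr.mono fun x hx => abs_of_nonneg hx), integral_add hf (integrable_const _), hf0,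
      integral_const, volume_torus_real, smul_eq_mul, flatDensity,
      mul_inv_cancel₀ (pow_pos hL.out d).ne', zero_add]
  -- Nonzero modes do not see the added constant, so these are coefficients of a probability
  -- density, bounded by its mass.
  have h2 : ∀ n ∈ modes k, ‖fourierInt (fun x => (f x : ℂ)) n‖ ≤ 1 := by
    intro n hn
    rw [← fourierInt_add_const hf (flatDensity d L) (fun h => zero_notMem_modes hk (h ▸ hn)), ← h1]
    exact norm_fourierInt_le _ n
  rw [← card_modes, trigProj]
  refine (Complex.abs_re_le_norm _).trans ?_
  rw [trigPoly_apply]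
  refine (norm_sum_le_of_le (f := _) (n := fun _ => flatDensity d L) _ fun n hn => ?_).trans
    (le_of_eq ?_)
  · rw [norm_mul, norm_mul, norm_torusChar, mul_one, Complex.norm_real, Real.norm_eq_abs,
      abs_of_pos hr]
    exact mul_le_of_le_one_right hr.le (h2 n hn)
  · rw [Finset.sum_const, nsmul_eq_mul, mul_comm]

/-! ### The coefficients of squares and cubes of basis functions -/

lemma fourier_re_mul (a b : ℤ) (x : AddCircle L) :
    (fourier a x).re * (fourier b x).re =
      ((fourier (a + b) x).re + (fourier (a - b) x).re) / 2 := by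
  rw [sub_eq_add_neg, fourier_add, fourier_add, fourier_neg]
  simp only [Complex.mul_re, Complex.conj_re, Complex.conj_im]
  ring

lemma integrable_fourier_re (n : ℤ) : Integrable fun x : AddCircle L => (fourier n x).re :=
  (by fun_prop : Continuous fun x : AddCircle L => (fourier n x).re).integrable_of_hasCompactSupport
    (HasCompactSupport.of_compactSpace _)

lemma integral_fourier_re (n : ℤ) :
    ∫ x : AddCircle L, (fourier n x).re = if n = 0 then L else 0 := by
  have hi : Integrable fun x : AddCircle L => fourier n x :=
    (map_continuous (fourier n)).integrable_of_hasCompactSupport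
      (HasCompactSupport.of_compactSpace _)
  have h := integral_re hi
  rw [integral_fourier] at h
  refine h.trans ?_
  split_ifs <;> simp

/-- Product-to-sum formulas leave frequencies 2k ± j and ±j, and only the zero frequency has nonzero
integral. -/
lemma integral_trig1_two (k j : ℕ) (hj : j = 2 * k ∨ j = 0) :
    ∫ x : AddCircle L, trig1 (k : ℤ) x * trig1 (k : ℤ) x * trig1 (j : ℤ) x =
      if k = 0 then L else if j = 0 then L / 2 else L / 4 := by
  have e : ∀ x : AddCircle L, trig1 (k : ℤ) x * trig1 (k : ℤ) x * trig1 (j : ℤ) x =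
      4⁻¹ * (((fourier (2 * k + j : ℤ) x).re + (fourier (2 * k - j : ℤ) x).re) +
        ((fourier (j : ℤ) x).re + (fourier (-j : ℤ) x).re)) := fun x => by
    rw [trig1_natCast, trig1_natCast, fourier_re_mul, add_div, add_mul, div_mul_eq_mul_div,
      div_mul_eq_mul_div, fourier_re_mul, fourier_re_mul, sub_self, zero_add, zero_sub, ← two_mul]
    ring
  simp only [e]
  have hp : ∀ a b : ℤ, Integrable fun x : AddCircle L => (fourier a x).re + (fourier b x).re :=
    fun a b => (integrable_fourier_re a).add (integrable_fourier_re b)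
  rw [integral_const_mul, integral_add (hp _ _) (hp _ _),
    integral_add (integrable_fourier_re _) (integrable_fourier_re _),
    integral_add (integrable_fourier_re _) (integrable_fourier_re _)]
  simp only [integral_fourier_re]
  rcases Nat.eq_zero_or_pos k with hk | hk
  · have : j = 0 := by omega
    subst hk this
    simp; ring
  · rcases hj with hj | hj
    · rw [if_neg (by omega), if_pos (by omega), if_neg (by omega), if_neg (by omega),
        if_neg (by omega), if_neg (by omega)]
      ring
    · rw [if_neg (by omega), if_neg (by omega), if_pos (by omega), if_pos (by omega),
        if_neg (by omega), if_pos (by omega)]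
      ring

/-- As before, cos³ has frequency k with weight 3 and 3k with weight 1; hence the ratio between the
two nontrivial values. -/
lemma integral_trig1_three (k l : ℕ) (hl : l = 3 * k ∨ l = k) :
    ∫ x : AddCircle L, trig1 (k : ℤ) x * trig1 (k : ℤ) x * trig1 (k : ℤ) x * trig1 (l : ℤ) x =
      if k = 0 then L else if l = k then 3 * L / 8 else L / 8 := by
  have e : ∀ x : AddCircle L,
      trig1 (k : ℤ) x * trig1 (k : ℤ) x * trig1 (k : ℤ) x * trig1 (l : ℤ) x =
      8⁻¹ * ((((fourier (3 * k + l : ℤ) x).re + (fourier (3 * k - l : ℤ) x).re) +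
        3 * ((fourier (k + l : ℤ) x).re + (fourier (k - l : ℤ) x).re))) := fun x => by
    have h1 := fourier_re_mul (k + k) (k + l) x
    have h2 := fourier_re_mul (k + k) (k - l) x
    have h3 := fourier_re_mul k k x
    have h4 := fourier_re_mul k l x
    rw [trig1_natCast, trig1_natCast, mul_assoc, h3, h4]
    rw [show (k + k + (k + l) : ℤ) = 3 * k + l by ring,
      show (k + k - (k + l) : ℤ) = k - l by ring] at h1
    rw [show (k + k + (k - l) : ℤ) = 3 * k - l by ring,
      show (k + k - (k - l) : ℤ) = k + l by ring] at h2
    rw [sub_self, fourier_zero, Complex.one_re]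
    linear_combination h1 / 4 + h2 / 4
  simp only [e]
  have hp : ∀ a b : ℤ, Integrable fun x : AddCircle L => (fourier a x).re + (fourier b x).re :=
    fun a b => (integrable_fourier_re a).add (integrable_fourier_re b)
  rw [integral_const_mul, integral_add (hp _ _) ((hp _ _).const_mul _),
    integral_const_mul, integral_add (integrable_fourier_re _) (integrable_fourier_re _),
    integral_add (integrable_fourier_re _) (integrable_fourier_re _)]
  simp only [integral_fourier_re]
  rcases Nat.eq_zero_or_pos k with hk | hk
  · have : l = 0 := by omega
    subst hk this
    simp; ring
  · rcases hl with hl | hl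
    · rw [if_neg (by omega), if_pos (by omega), if_neg (by omega), if_neg (by omega),
        if_neg (by omega), if_neg (by omega)]
      ring
    · rw [if_neg (by omega), if_neg (by omega), if_neg (by omega), if_pos (by omega),
        if_neg (by omega), if_pos (by omega)]
      ring

lemma flipMode_one (k : Fin d → ℤ) : flipMode 1 k = k := by
  ext i; simp [flipMode]

lemma rpow_half_sq : (L ^ ((d : ℝ) / 2)) ^ 2 = L ^ d := by
  rw [← Real.rpow_natCast, ← Real.rpow_mul hL.out.le, ← Real.rpow_natCast]
  congr 1; push_cast; ring

lemma prod_const_div_Theta (k : Fin d → ℤ) :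
    ∏ i, L / Real.sqrt (2 - if k i = 0 then 1 else 0) = L ^ d / Theta k := by
  rw [Finset.prod_div_distrib, Finset.prod_const, Finset.card_univ, Fintype.card_fin, Theta]

/-- The integral factorises. With the normalising square roots included, each coordinate contributes
L, or L/√2 when j i ≠ 0. -/
lemma c2_one_sq {k j : Fin d → ℕ} (hj : j ∈ P2 k) :
    c2 L k 1 1 j ^ 2 = flatDensity d L / Theta (natMode j) ^ 2 := by
  have hj' : ∀ i, j i = 2 * k i ∨ j i = 0 := by
    simpa [Fintype.mem_piFinset] using (Finset.mem_erase.1 hj).2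
  have hs : 0 < L ^ ((d : ℝ) / 2) := Real.rpow_pos_of_pos hL.out _
  have hs2 := rpow_half_sq (d := d) (L := L)
  have hΘ := Theta_pos (natMode j)
  have key : c2 L k 1 1 j = (L ^ ((d : ℝ) / 2))⁻¹ ^ 3 * (L ^ d / Theta (natMode j)) := by
    have e : ∀ x : Torus d L, basisFn (natMode k) x * basisFn (natMode k) x *
        basisFn (natMode j) x = (L ^ ((d : ℝ) / 2))⁻¹ ^ 3 * ∏ i,
          (Real.sqrt (2 - if (natMode k) i = 0 then 1 else 0) ^ 2 *
            Real.sqrt (2 - if (natMode j) i = 0 then 1 else 0) *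
          (trig1 (k i : ℤ) (x i) * trig1 (k i : ℤ) (x i) * trig1 (j i : ℤ) (x i))) := fun x => by
      simp only [basisFn, normConst, Theta, Finset.prod_mul_distrib, Finset.prod_pow, natMode]
      ring
    simp only [c2, coeff, mul_one, flipMode_one, e]
    rw [integral_const_mul]
    congr 1
    rw [← prod_const_div_Theta, integral_fintype_prod_volume_eq_prod (fun i (y : AddCircle L) =>
      Real.sqrt (2 - if (natMode k) i = 0 then 1 else 0) ^ 2 *
            Real.sqrt (2 - if (natMode j) i = 0 then 1 else 0) *
          (trig1 (k i : ℤ) y * trig1 (k i : ℤ) y * trig1 (j i : ℤ) y))]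
    refine Finset.prod_congr rfl fun i _ => ?_
    rw [integral_const_mul, integral_trig1_two _ _ (hj' i)]
    by_cases hk : k i = 0
    · have : j i = 0 := by have := hj' i; omega
      simp [natMode, hk, this]; norm_num
    · rcases hj' i with h | h
      · have h0 : j i ≠ 0 := by omega
        have h2 : Real.sqrt 2 ^ 2 = 2 := Real.sq_sqrt (by norm_num)
        have h3 : Real.sqrt 2 ≠ 0 := by positivity
        simp only [natMode, Nat.cast_eq_zero, hk, h0, if_false, sub_zero, h2]
        field_simp
        rw [h2]; ring
      · simp [natMode, hk, h]; norm_num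
        ring
  rw [key, flatDensity, ← hs2]
  field_simp

/-- Coordinates with k i ≠ 0 contribute 3L/2 or L/2 according to whether l i is k i or 3 k i. The
worst value L/2 everywhere gives the bound, which suffices below. -/
lemma c3_one_sq {k l : Fin d → ℕ} (hl : l ∈ P3 k) :
    flatDensity d L ^ 2 / Theta (natMode k) ^ 4 ≤ c3 L k 1 1 1 l ^ 2 := by
  have hl' : ∀ i, l i = 3 * k i ∨ l i = k i := by
    simpa [Fintype.mem_piFinset] using (Finset.mem_erase.1 hl).2
  have hs : 0 < L ^ ((d : ℝ) / 2) := Real.rpow_pos_of_pos hL.out _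
  have hs2 := rpow_half_sq (d := d) (L := L)
  have hL0 := hL.out
  have hΘ := Theta_pos (natMode k)
  have key : (L ^ ((d : ℝ) / 2))⁻¹ ^ 4 * (L ^ d / Theta (natMode k) ^ 2) ≤ c3 L k 1 1 1 l := by
    have e : ∀ x : Torus d L, basisFn (natMode k) x * basisFn (natMode k) x *
        basisFn (natMode k) x * basisFn (natMode l) x = (L ^ ((d : ℝ) / 2))⁻¹ ^ 4 * ∏ i,
          (Real.sqrt (2 - if (natMode k) i = 0 then 1 else 0) ^ 3 *
            Real.sqrt (2 - if (natMode l) i = 0 then 1 else 0) *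
          (trig1 (k i : ℤ) (x i) * trig1 (k i : ℤ) (x i) * trig1 (k i : ℤ) (x i) *
            trig1 (l i : ℤ) (x i))) := fun x => by
      simp only [basisFn, normConst, Theta, Finset.prod_mul_distrib, Finset.prod_pow, natMode]
      ring
    simp only [c3, coeff, mul_one, flipMode_one, e]
    rw [integral_const_mul]
    refine mul_le_mul_of_nonneg_left ?_ (by positivity)
    rw [integral_fintype_prod_volume_eq_prod (fun i (y : AddCircle L) =>
      Real.sqrt (2 - if (natMode k) i = 0 then 1 else 0) ^ 3 *
            Real.sqrt (2 - if (natMode l) i = 0 then 1 else 0) *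
          (trig1 (k i : ℤ) y * trig1 (k i : ℤ) y * trig1 (k i : ℤ) y * trig1 (l i : ℤ) y))]
    have e3 : L ^ d / Theta (natMode k) ^ 2 =
        ∏ i, L / (2 - if (natMode k) i = 0 then 1 else 0 : ℝ) := by
      rw [Finset.prod_div_distrib, Finset.prod_const, Finset.card_univ, Fintype.card_fin, Theta_sq]
    rw [e3]
    refine Finset.prod_le_prod (fun i _ => by split_ifs <;> norm_num <;> linarith) fun i _ => ?_
    rw [integral_const_mul, integral_trig1_three _ _ (hl' i)]
    by_cases hk : k i = 0
    · have : l i = 0 := by have := hl' i; omega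
      simp [natMode, hk, this]; norm_num
    · have h0 : l i ≠ 0 := by have := hl' i; omega
      have h2 : Real.sqrt 2 ^ 2 = 2 := Real.sq_sqrt (by norm_num)
      have h4 : Real.sqrt 2 ^ 3 * Real.sqrt 2 = 4 := by
        rw [← pow_succ, show 3 + 1 = 2 * 2 by norm_num, pow_mul, h2]; norm_num
      simp only [natMode, Nat.cast_eq_zero, hk, h0, if_false, sub_zero, h4]
      split_ifs <;> linarith
  have h0 : 0 ≤ (L ^ ((d : ℝ) / 2))⁻¹ ^ 4 * (L ^ d / Theta (natMode k) ^ 2) := by positivity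
  refine le_trans (le_of_eq ?_) (pow_le_pow_left₀ h0 key 2)
  rw [flatDensity, ← hs2]
  field_simp

/-! ### Lower bounds for the symbol on the harmonics -/

/-- The modes 2k and 3k are distinct elements. -/
lemma two_le_card_harmonics {k : Fin d → ℕ} (hk : k ≠ 0) : 2 ≤ (P2 k ∪ P3 k).card := by
  obtain ⟨i, hi⟩ := exists_pos_of_ne_zero hk
  have h2 : (fun i => 2 * k i) ∈ P2 k := by
    refine Finset.mem_erase.2 ⟨fun h => ?_, by simp [Fintype.mem_piFinset]⟩
    have := congrFun h i
    simp at this; omega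
  have h3 : (fun i => 3 * k i) ∈ P3 k := by
    refine Finset.mem_erase.2 ⟨fun h => ?_, by simp [Fintype.mem_piFinset]⟩
    have : 3 * k i = k i := congrFun h i
    omega
  refine Finset.one_lt_card.2 ⟨_, Finset.mem_union_left _ h2, _, Finset.mem_union_right _ h3, ?_⟩
  intro h
  have : 2 * k i = 3 * k i := congrFun h i
  omega

lemma Theta_eq_of_mem_P3 {k l : Fin d → ℕ} (hl : l ∈ P3 k) :
    Theta (natMode l) = Theta (natMode k) := by
  have hl' : ∀ i, l i = 3 * k i ∨ l i = k i := by
    simpa [Fintype.mem_piFinset] using (Finset.mem_erase.1 hl).2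
  unfold Theta
  refine Finset.prod_congr rfl fun i _ => ?_
  have : natMode l i = 0 ↔ natMode k i = 0 := by
    have := hl' i
    show (l i : ℤ) = 0 ↔ (k i : ℤ) = 0
    omega
  rw [if_congr this rfl rfl]

/-- After `c2_one_sq` the factor is 6 Θ(j)² |P₂ ∪ P₃|, and 24 = 6 · 2 · 2. -/
lemma second_harmonic_bound {W : Torus d L → ℝ} {k j : Fin d → ℕ} (hk : k ≠ 0) (hj : j ∈ P2 k)
    (hA : 6 * Theta (natMode j) ^ 5 * c2 L k 1 1 j ^ 2 * ((P2 k ∪ P3 k).card : ℝ) /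
      (flatDensity d L * Theta (natMode k)) * |coeff W (natMode k)| < coeff W (natMode j)) :
    24 * (|coeff W (natMode k)| / Theta (natMode k)) ≤ coeff W (natMode j) / Theta (natMode j) := by
  have hr := flatDensity_pos d L
  have hΘj := Theta_pos (natMode j)
  have hΘk := Theta_pos (natMode k)
  have hj0 : j ≠ 0 := (Finset.mem_erase.1 hj).1
  have h2 := two_le_Theta_sq hj0
  have hN : (2 : ℝ) ≤ (P2 k ∪ P3 k).card := by exact_mod_cast two_le_card_harmonics hk
  rw [c2_one_sq hj] at hA
  rw [le_div_iff₀ hΘj]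
  refine le_trans ?_ hA.le
  rw [show 6 * Theta (natMode j) ^ 5 * (flatDensity d L / Theta (natMode j) ^ 2) *
    ((P2 k ∪ P3 k).card : ℝ) / (flatDensity d L * Theta (natMode k)) * |coeff W (natMode k)| =
    (6 * (Theta (natMode j) ^ 2 * ((P2 k ∪ P3 k).card : ℝ))) *
      (|coeff W (natMode k)| / Theta (natMode k) * Theta (natMode j)) by field_simp, mul_assoc]
  refine mul_le_mul_of_nonneg_right ?_ (by positivity)
  nlinarith [mul_le_mul h2 hN (by norm_num) (by positivity)]

/-- Here Θ(l) = Θ(k); `c3_one_sq` removes four powers of Θ(k), and |P₂ ∪ P₃| ≥ 2 turns 2/3 into 4/3.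
-/
lemma third_harmonic_bound {W : Torus d L → ℝ} {k l : Fin d → ℕ} (hk : k ≠ 0) (hl : l ∈ P3 k)
    (hA : 2 * Theta (natMode l) ^ 9 * Theta (natMode k) * c3 L k 1 1 1 l ^ 2 *
      ((P2 k ∪ P3 k).card : ℝ) / (3 * flatDensity d L ^ 2) * |coeff W (natMode k)| <
        coeff W (natMode l)) :
    4 / 3 * (Theta (natMode k) ^ 2) ^ 3 * (|coeff W (natMode k)| / Theta (natMode k)) ≤
      coeff W (natMode l) / Theta (natMode l) := by
  have hr := flatDensity_pos d L
  have hΘk := Theta_pos (natMode k)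
  have hN : (2 : ℝ) ≤ (P2 k ∪ P3 k).card := by exact_mod_cast two_le_card_harmonics hk
  rw [Theta_eq_of_mem_P3 hl] at hA ⊢
  rw [le_div_iff₀ hΘk]
  refine le_trans ?_ hA.le
  have e : 4 / 3 * (Theta (natMode k) ^ 2) ^ 3 * (|coeff W (natMode k)| / Theta (natMode k)) *
      Theta (natMode k) = 2 * Theta (natMode k) ^ 9 * Theta (natMode k) *
        (flatDensity d L ^ 2 / Theta (natMode k) ^ 4) * 2 / (3 * flatDensity d L ^ 2) *
          |coeff W (natMode k)| := by field_simp; ring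
  rw [e]
  have := c3_one_sq (L := L) hl
  gcongr

lemma absMode_eq_of_mem_modes {k : Fin d → ℕ} {n : Fin d → ℤ} (h : n ∈ modes k) :
    absMode n = k := by
  ext i
  have := mem_modes.1 h i
  simp only [absMode]; omega

lemma mem_modes_of_absMode_eq {k : Fin d → ℕ} {n : Fin d → ℤ} (h : absMode n = k) :
    n ∈ modes k := by
  refine mem_modes.2 fun i => ?_
  have := congrFun h i
  simp only [absMode] at this; omega

lemma absMode_mem_P2 {k : Fin d → ℕ} {n : Fin d → ℤ} (h : n ∈ modes2 k) : absMode n ∈ P2 k := by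
  rw [mem_modes2] at h
  refine Finset.mem_erase.2 ⟨fun h0 => h.1 ?_, Fintype.mem_piFinset.2 fun i => ?_⟩
  · ext i
    have := congrFun h0 i
    simpa [absMode] using this
  · have := h.2 i
    simp only [absMode, Finset.mem_insert, Finset.mem_singleton]; omega

lemma absMode_mem_P3 {k : Fin d → ℕ} {n : Fin d → ℤ} (h : n ∈ modes3 k) : absMode n ∈ P3 k := by
  rw [mem_modes3] at h
  refine Finset.mem_erase.2 ⟨fun h0 => h.2 (mem_modes_of_absMode_eq h0),
    Fintype.mem_piFinset.2 fun i => ?_⟩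
  have := h.1 i
  simp only [absMode, Finset.mem_insert, Finset.mem_singleton]; omega

/-! ### Coercivity of the free energy at the critical parameter -/

/-- The fourth power of max(1, |x|, |y|) dominates the monomial and is one of 1, x⁴, y⁴. Thus every
integrand of the expansions is integrable as soon as the functions lie in L⁴. -/
lemma abs_pow_mul_pow_le (x y : ℝ) {a b : ℕ} (hab : a + b ≤ 4) :
    |x ^ a * y ^ b| ≤ 1 + x ^ 4 + y ^ 4 := by
  set M := max 1 (max |x| |y|) with hM
  have h1 : 1 ≤ M := le_max_left _ _
  have hx : |x| ≤ M := (le_max_left _ _).trans (le_max_right _ _)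
  have hy : |y| ≤ M := (le_max_right _ _).trans (le_max_right _ _)
  have h4 : M ^ 4 ≤ 1 + x ^ 4 + y ^ 4 := by
    have hx4 : 0 ≤ x ^ 4 := by positivity
    have hy4 : 0 ≤ y ^ 4 := by positivity
    rcases max_choice 1 (max |x| |y|) with h | h
    · rw [hM, h]; linarith
    · rcases max_choice |x| |y| with h' | h'
      · rw [hM, h, h', Even.pow_abs (by decide)]; linarith
      · rw [hM, h, h', Even.pow_abs (by decide)]; linarith
  calc |x ^ a * y ^ b| = |x| ^ a * |y| ^ b := by rw [abs_mul, abs_pow, abs_pow]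
    _ ≤ M ^ a * M ^ b := by gcongr
    _ = M ^ (a + b) := (pow_add _ _ _).symm
    _ ≤ M ^ 4 := pow_le_pow_right₀ h1 hab
    _ ≤ _ := h4

lemma integrable_pow_four {f : Torus d L → ℝ} (hf : MemLp f 4) :
    Integrable fun x => f x ^ 4 := by
  have h := hf.integrable_norm_pow (p := 4) (by norm_num)
  refine h.congr (ae_of_all _ fun x => ?_)
  simp only [Real.norm_eq_abs]
  exact Even.pow_abs (by decide) _

lemma integrable_pow_mul_pow {f g : Torus d L → ℝ} (hf : MemLp f 4) (hg : MemLp g 4) {a b : ℕ}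
    (hab : a + b ≤ 4) : Integrable fun x => f x ^ a * g x ^ b :=
  (((integrable_const 1).add (integrable_pow_four hf)).add (integrable_pow_four hg)).mono'
    ((hf.aestronglyMeasurable.pow a).mul (hg.aestronglyMeasurable.pow b))
    (ae_of_all _ fun _ => abs_pow_mul_pow_le _ _ hab)

lemma integrable_pow {f : Torus d L → ℝ} (hf : MemLp f 4) {a : ℕ} (ha : a ≤ 4) :
    Integrable fun x => f x ^ a := by
  simpa using integrable_pow_mul_pow hf hf (a := a) (b := 0) (by omega)

/-- `f` is integrable with integral `I`. -/
def HasInt (f : Torus d L → ℝ) (I : ℝ) : Prop := Integrable f ∧ ∫ x, f x = I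

/-- Carrying integrability and value together lets a long linear combination be integrated by one
term. -/
lemma HasInt.add {f g : Torus d L → ℝ} {I J : ℝ} (hf : HasInt f I) (hg : HasInt g J) :
    HasInt (fun x => f x + g x) (I + J) :=
  ⟨hf.1.add hg.1, by rw [integral_add hf.1 hg.1, hf.2, hg.2]⟩

lemma HasInt.mul {f : Torus d L → ℝ} {I : ℝ} (hf : HasInt f I) (c : ℝ) :
    HasInt (fun x => c * f x) (c * I) :=
  ⟨hf.1.const_mul c, by rw [integral_const_mul, hf.2]⟩

lemma Integrable.hasInt {f : Torus d L → ℝ} (hf : Integrable f) : HasInt f (∫ x, f x) :=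
  ⟨hf, rfl⟩

lemma HasInt.congr {f g : Torus d L → ℝ} {I J : ℝ} (hf : HasInt f I) (hfg : ∀ x, f x = g x)
    (hIJ : I = J) : HasInt g J := by
  obtain rfl : f = g := funext hfg
  exact hIJ ▸ hf

/-- The pointwise inequality behind coercivity. Here `u` is the critical component of `f`, and
`v₂`, `v₃` are its second and third harmonics. -/
lemma coercivity_pointwise {s Q f u v₂ v₃ : ℝ} (hs : 0 ≤ s) (hQ : 2 ≤ Q) (hu : |s * u| ≤ Q) :
    s ^ 2 / 144 * f ^ 4 ≤ (f ^ 2 + (-2) * (u * f) + u ^ 2) + 24 * v₂ ^ 2 + 4 / 3 * Q ^ 3 * v₃ ^ 2 +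
      2 / 3 * s * (f ^ 3 + (-1) * u ^ 3) + 2 * s * (u ^ 3 + (-1) * (u ^ 2 * f) + u ^ 2 * v₂) +
      2 / 3 * s ^ 2 * (u ^ 3 * (u + v₃) + (-1) * (u ^ 3 * f)) + s ^ 2 / 6 * f ^ 4 := by
  obtain ⟨v, rfl⟩ : ∃ v, f = u + v := ⟨f - u, by ring⟩
  -- With f = u + v, this square absorbs all terms containing v except s²v⁴/18, where 1/18 = 1/6 -
  -- 1/9.
  have h1 : 0 ≤ (v * (1 + s * u) + s * v ^ 2 / 3) ^ 2 := sq_nonneg _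
  -- The cross term 2su²v₂ is completed to a square at the cost of s²u⁴/24, taken from the s²u⁴/6 of
  -- the quartic.
  have h2 : 0 ≤ 24 * (v₂ + s * u ^ 2 / 24) ^ 2 := by positivity
  -- Bounding one factor su by Q and Q³ from below by 2Q² reduces this to (8/3)(Q|v₃| - su²/8)², at
  -- the cost of another s²u⁴/24.
  have h3 : 0 ≤ 4 / 3 * Q ^ 3 * v₃ ^ 2 + 2 / 3 * s ^ 2 * u ^ 3 * v₃ + s ^ 2 * u ^ 4 / 24 := by
    have a1 : 2 * Q ^ 2 * v₃ ^ 2 ≤ Q ^ 3 * v₃ ^ 2 := by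
      have : 2 * Q ^ 2 ≤ Q ^ 3 := by nlinarith [sq_nonneg Q]
      exact mul_le_mul_of_nonneg_right this (sq_nonneg _)
    have hz : 0 ≤ s * u ^ 2 := by positivity
    have a2 : -(Q * |v₃|) ≤ s * u * v₃ := by
      refine le_trans (neg_le_neg ?_) (neg_abs_le _)
      rw [abs_mul]
      exact mul_le_mul_of_nonneg_right hu (abs_nonneg _)
    have a3 := mul_le_mul_of_nonneg_right a2 hz
    have a4 : 0 ≤ (Q * |v₃| - s * u ^ 2 / 8) ^ 2 := sq_nonneg _
    have a5 : |v₃| ^ 2 = v₃ ^ 2 := sq_abs _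
    nlinarith
  -- What remains is s²(u⁴/12 + v⁴/18), and 144 = 18 · 8.
  have h4 : s ^ 2 * (u + v) ^ 4 ≤ 8 * s ^ 2 * (u ^ 4 + v ^ 4) := by
    have : (u + v) ^ 4 ≤ 8 * (u ^ 4 + v ^ 4) := by
      nlinarith [sq_nonneg (u - v), sq_nonneg (u ^ 2 - v ^ 2), sq_nonneg (u + v),
        mul_nonneg (sq_nonneg (u - v)) (sq_nonneg (u + v)), sq_nonneg ((u - v) ^ 2)]
    nlinarith [mul_le_mul_of_nonneg_left this (sq_nonneg s)]
  have h5 : 0 ≤ s ^ 2 * u ^ 4 := by positivity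
  nlinarith

/-- The spectral conditions on the potential: `k` is the only negative mode, and its second and
third harmonics are sufficiently stable. -/
structure SpectralGap (W : Torus d L → ℝ) (k : Fin d → ℕ) (κ : ℝ) : Prop where
  nonneg : ∀ n, n ∉ modes k → 0 ≤ symbol W n
  critical : ∀ n ∈ modes k, symbol W n = -κ
  second : ∀ n ∈ modes2 k, 24 * κ ≤ symbol W n
  third : ∀ n ∈ modes3 k, 4 / 3 * (Theta (natMode k) ^ 2) ^ 3 * κ ≤ symbol W n

/-- By Parseval the interaction is a sum over modes; those outside the three disjoint families
contribute nonnegatively and are dropped. -/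
lemma interaction_lower_bound {W : Torus d L → ℝ} (hW : IsPotential W) {k : Fin d → ℕ}
    (hk : k ≠ 0) {κ : ℝ} (hgap : SpectralGap W k κ) {f : Torus d L → ℝ} (hf : MemLp f 2) :
    κ * (-(∫ x, trigProj (modes k) f x ^ 2) + 24 * (∫ x, trigProj (modes2 k) f x ^ 2) +
      4 / 3 * (Theta (natMode k) ^ 2) ^ 3 * ∫ x, trigProj (modes3 k) f x ^ 2) ≤
      ∫ x, f x * conv W f x := by
  have hr := flatDensity_pos d L
  have hd1 : Disjoint (modes k ∪ modes2 k) (modes3 k) :=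
    Finset.disjoint_union_left.2 ⟨disjoint_modes_modes3 k, disjoint_modes2_modes3 hk⟩
  refine le_trans ?_ (sum_le_hasSum (modes k ∪ modes2 k ∪ modes3 k) (fun n hn => ?_)
    (hasSum_interaction hW hf))
  · rw [Finset.sum_union hd1, Finset.sum_union (disjoint_modes_modes2 hk),
      integral_trigProj_sq fun n => neg_mem_modes (k := k) (n := n),
      integral_trigProj_sq fun n => neg_mem_modes2 (k := k) (n := n),
      integral_trigProj_sq fun n => neg_mem_modes3 (k := k) (n := n)]
    rw [mul_add, mul_add]
    refine add_le_add (add_le_add ?_ ?_) ?_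
    · rw [mul_neg, ← neg_mul, Finset.mul_sum]
      refine Finset.sum_le_sum fun n hn => le_of_eq ?_
      rw [hgap.critical n hn]; ring
    · rw [← mul_assoc, Finset.mul_sum]
      refine Finset.sum_le_sum fun n hn => ?_
      rw [mul_left_comm]
      refine mul_le_mul_of_nonneg_left (mul_le_mul_of_nonneg_right ?_ (by positivity)) hr.le
      rw [mul_comm]; exact hgap.second n hn
    · rw [← mul_assoc, Finset.mul_sum]
      refine Finset.sum_le_sum fun n hn => ?_
      rw [mul_left_comm]
      refine mul_le_mul_of_nonneg_left (mul_le_mul_of_nonneg_right ?_ (by positivity)) hr.le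
      rw [mul_comm]; exact hgap.third n hn
  · have : n ∉ modes k := fun h => hn (by simp [h])
    exact mul_nonneg hr.le (mul_nonneg (hgap.nonneg n this) (by positivity))

/-- Quartic coercivity at the critical parameter. -/
theorem coercivity {W : Torus d L → ℝ} (hW : IsPotential W) {k : Fin d → ℕ} (hk : k ≠ 0)
    {b : ℝ} (hb : 0 ≤ b) (hgap : SpectralGap W k (4 * flatDensity d L ^ 2 * b))
    {f : Torus d L → ℝ} (hf : MemLp f 4) (hf0 : ∫ x, f x = 0)
    (hfr : ∀ᵐ x, 0 ≤ f x + flatDensity d L) :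
    b / 72 * ∫ x, f x ^ 4 ≤
      b / 3 * (6 * flatDensity d L ^ 2 * (∫ x, f x ^ 2) + 4 * flatDensity d L * (∫ x, f x ^ 3) +
        ∫ x, f x ^ 4) + 1 / 2 * ∫ x, f x * conv W f x := by
  have hf2 : MemLp f 2 := hf.mono_exponent (by norm_num)
  have hfi : Integrable f := hf.integrable (by norm_num)
  have hr := flatDensity_pos d L
  set r := flatDensity d L with hrdef
  set Q := Theta (natMode k) ^ 2 with hQ
  have hQ2 : 2 ≤ Q := two_le_Theta_sq hk
  set u := trigProj (modes k) f with hu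
  set v₂ := trigProj (modes2 k) f with hv₂
  set v₃ := trigProj (modes3 k) f with hv₃
  have mu : MemLp u 4 := memLp_of_continuous (continuous_trigProj _ _) 4
  have m2 : MemLp v₂ 4 := memLp_of_continuous (continuous_trigProj _ _) 4
  have m3 : MemLp v₃ 4 := memLp_of_continuous (continuous_trigProj _ _) 4
  obtain ⟨i1, i2, i3, i4⟩ := integral_projections hk hfi hf0
  have hI := interaction_lower_bound hW hk hgap hf2
  rw [← hu] at i1 i2 i3 i4
  rw [← hv₂] at i3
  rw [← hv₃] at i4
  rw [← hu, ← hv₂, ← hv₃, ← hQ] at hI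
  have H : ∀ {a : ℕ}, a ≤ 4 → HasInt (fun x => f x ^ a) (∫ x, f x ^ a) :=
    fun ha => Integrable.hasInt (integrable_pow hf ha)
  have Hu : ∀ {a : ℕ}, a ≤ 4 → HasInt (fun x => u x ^ a) (∫ x, u x ^ a) :=
    fun ha => Integrable.hasInt (integrable_pow mu ha)
  have H2 := Integrable.hasInt (integrable_pow m2 (a := 2) (by norm_num))
  have H3 := Integrable.hasInt (integrable_pow m3 (a := 2) (by norm_num))
  have U1 : HasInt (fun x => u x * f x) (∫ x, u x ^ 2) := by
    rw [← i1]
    have := integrable_pow_mul_pow mu hf (a := 1) (b := 1) (by norm_num)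
    simp only [pow_one] at this
    exact Integrable.hasInt this
  have U2 : HasInt (fun x => u x ^ 2 * f x) (∫ x, u x ^ 2 * v₂ x) := by
    rw [← i3]
    have := integrable_pow_mul_pow mu hf (a := 2) (b := 1) (by norm_num)
    simp only [pow_one] at this
    exact Integrable.hasInt this
  have U3 : HasInt (fun x => u x ^ 3 * f x) (∫ x, u x ^ 3 * (u x + v₃ x)) := by
    rw [← i4]
    have := integrable_pow_mul_pow mu hf (a := 3) (b := 1) (by norm_num)
    simp only [pow_one] at this
    exact Integrable.hasInt this
  have V2 : HasInt (fun x => u x ^ 2 * v₂ x) (∫ x, u x ^ 2 * v₂ x) := by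
    have := integrable_pow_mul_pow mu m2 (a := 2) (b := 1) (by norm_num)
    simp only [pow_one] at this
    exact Integrable.hasInt this
  have V3 : HasInt (fun x => u x ^ 3 * (u x + v₃ x)) (∫ x, u x ^ 3 * (u x + v₃ x)) := by
    have := integrable_pow_mul_pow mu (mu.add m3) (a := 3) (b := 1) (by norm_num)
    simp only [pow_one, Pi.add_apply] at this
    exact Integrable.hasInt this
  have Hu3 := Hu (a := 3) (by norm_num)
  rw [i2] at Hu3
  -- Combinations such as u³ - u²f + u²v₂ integrate to zero by the projection identities; they are
  -- included only to make the pointwise inequality true.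
  have T := (((((((H (a := 2) (by norm_num)).add (U1.mul (-2))).add (Hu (a := 2) (by norm_num))).add
    (H2.mul 24)).add (H3.mul (4 / 3 * Q ^ 3))).add
    (((H (a := 3) (by norm_num)).add (Hu3.mul (-1))).mul (2 / 3 * r⁻¹))).add
    (((Hu3.add (U2.mul (-1))).add V2).mul (2 * r⁻¹))).add
    ((V3.add (U3.mul (-1))).mul (2 / 3 * r⁻¹ ^ 2)) |>.add ((H (a := 4) le_rfl).mul (r⁻¹ ^ 2 / 6))
  have T0 := (H (a := 4) le_rfl).mul (r⁻¹ ^ 2 / 144)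
  have key := integral_mono T0.1 T.1 fun x => coercivity_pointwise (s := r⁻¹) (Q := Q) (f := f x)
    (u := u x) (v₂ := v₂ x) (v₃ := v₃ x) (inv_pos.2 hr).le hQ2 (by
      rw [abs_mul, abs_of_pos (inv_pos.2 hr), inv_mul_le_iff₀ hr]
      exact abs_trigProj_modes_le hk hfi hf0 hfr x)
  rw [T0.2, T.2] at key
  -- The factor 2br² is the coefficient of ∫ f² in the entropy, and equals κ/2 because κ = 4r²b;
  -- this matches entropy and interaction.
  have key2 := mul_le_mul_of_nonneg_left key (by positivity : 0 ≤ 2 * b * r ^ 2)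
  have e1 : 2 * b * r ^ 2 * (r⁻¹ ^ 2 / 144 * ∫ x, f x ^ 4) = b / 72 * ∫ x, f x ^ 4 := by
    field_simp; ring
  rw [e1] at key2
  refine key2.trans ?_
  have e2 : ∀ A B C D E F G : ℝ, 2 * b * r ^ 2 * (A + -2 * D + D + 24 * E + 4 / 3 * Q ^ 3 * F +
      2 / 3 * r⁻¹ * (B + -1 * 0) + 2 * r⁻¹ * (0 + -1 * G + G) + 2 / 3 * r⁻¹ ^ 2 * (0 + -1 * 0) +
      r⁻¹ ^ 2 / 6 * C) = b / 3 * (6 * r ^ 2 * A + 4 * r * B + C) +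
        1 / 2 * (4 * r ^ 2 * b * (-D + 24 * E + 4 / 3 * Q ^ 3 * F)) := by
    intros; field_simp; ring
  have e3 := e2 (∫ x, f x ^ 2) (∫ x, f x ^ 3) (∫ x, f x ^ 4) (∫ x, u x ^ 2) (∫ x, v₂ x ^ 2)
    (∫ x, v₃ x ^ 2) (∫ x, u x ^ 2 * v₂ x)
  have e4 : ∀ z : ℝ, z + -1 * z = 0 + -1 * 0 := fun z => by ring
  rw [e4, e3]
  linarith

/-! ### The free energy of densities -/

/-- The quartic free energy of a density. -/
def energy (W : Torus d L → ℝ) (β : ℝ) (f : Torus d L → ℝ) : ℝ :=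
  β⁻¹ / 3 * (∫ x, f x ^ 4) - β⁻¹ / 3 + 1 / 2 * ∫ x, f x * conv W f x

lemma energy_congr {W : Torus d L → ℝ} {β : ℝ} {f g : Torus d L → ℝ} (h : f =ᵐ[volume] g) :
    energy W β f = energy W β g := by
  have hc : conv W f = conv W g := by
    ext x
    exact integral_congr_ae (h.mono fun y hy => by simp only [hy])
  have h4 : ∫ x, f x ^ 4 = ∫ x, g x ^ 4 :=
    integral_congr_ae (h.mono fun y hy => by simp only [hy])
  have hI : ∫ x, f x * conv W g x = ∫ x, g x * conv W g x :=
    integral_congr_ae (h.mono fun y hy => by simp only [hy])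
  rw [energy, energy, hc, h4, hI]

lemma integrable_mul_conv {W f g : Torus d L → ℝ} (hW : Continuous W) (hf : Integrable f)
    (hg : Integrable g) : Integrable fun x => f x * conv W g x := by
  obtain ⟨C, -, hC⟩ := exists_bound_of_continuous hW
  exact hf.mul_bdd (c := C * ∫ y, |g y|) (continuous_conv hW hg).aestronglyMeasurable
    (ae_of_all _ fun x => abs_conv_le hC hg x)

/-- The expansion of the free energy along a line. -/
lemma energy_line {W : Torus d L → ℝ} (hW : IsPotential W) (β : ℝ) {f g : Torus d L → ℝ}
    (hf : MemLp f 4) (hg : MemLp g 4) (t : ℝ) :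
    energy W β (fun x => f x + t * g x) = energy W β f +
      t * (4 * β⁻¹ / 3 * (∫ x, f x ^ 3 * g x) + ∫ x, g x * conv W f x) +
      t ^ 2 * (2 * β⁻¹ * (∫ x, f x ^ 2 * g x ^ 2) + 1 / 2 * ∫ x, g x * conv W g x) +
      t ^ 3 * (4 * β⁻¹ / 3 * ∫ x, f x * g x ^ 3) + t ^ 4 * (β⁻¹ / 3 * ∫ x, g x ^ 4) := by
  have hfi : Integrable f := hf.integrable (by norm_num)
  have hgi : Integrable g := hg.integrable (by norm_num)
  have H31 := integrable_pow_mul_pow hf hg (a := 3) (b := 1) (by norm_num)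
  have H13 := integrable_pow_mul_pow hf hg (a := 1) (b := 3) (by norm_num)
  simp only [pow_one] at H31 H13
  have P := ((((Integrable.hasInt (integrable_pow_four hf)).add
    ((Integrable.hasInt H31).mul (4 * t))).add
    ((Integrable.hasInt (integrable_pow_mul_pow hf hg (a := 2) (b := 2) (by norm_num))).mul
      (6 * t ^ 2))).add ((Integrable.hasInt H13).mul (4 * t ^ 3))).add
    ((Integrable.hasInt (integrable_pow_four hg)).mul (t ^ 4))
  have P' := (P.congr (g := fun x => (f x + t * g x) ^ 4) (fun x => by ring) rfl).2
  have I := (((Integrable.hasInt (integrable_mul_conv hW.cont hfi hfi)).add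
    ((Integrable.hasInt (integrable_mul_conv hW.cont hfi hgi)).mul t)).add
    ((Integrable.hasInt (integrable_mul_conv hW.cont hgi hfi)).mul t)).add
    ((Integrable.hasInt (integrable_mul_conv hW.cont hgi hgi)).mul (t ^ 2))
  have I' := (I.congr (g := fun x => (f x + t * g x) * conv W (fun x => f x + t * g x) x)
    (fun x => by rw [conv_add hW.cont hfi (hgi.const_mul t), conv_const_mul]; ring) rfl).2
  rw [energy, energy, P', I', integral_mul_conv_comm hW hgi hfi]
  ring

/-- Probability densities of finite free energy. -/
structure IsDensity (f : Torus d L → ℝ) : Prop where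
  memLp : MemLp f 4
  nonneg : ∀ᵐ x, 0 ≤ f x
  integral_eq : ∫ x, f x = 1

lemma IsDensity.integrable {f : Torus d L → ℝ} (hf : IsDensity f) : Integrable f :=
  hf.memLp.integrable (by norm_num)

lemma isDensity_flat : IsDensity fun _ : Torus d L => flatDensity d L where
  memLp := memLp_const _
  nonneg := ae_of_all _ fun _ => (flatDensity_pos d L).le
  integral_eq := by
    rw [integral_const, volume_torus_real, smul_eq_mul, flatDensity,
      mul_inv_cancel₀ (pow_pos hL.out d).ne']

/-- The excess free energy of `r + f` over the flat density `r`. -/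
lemma energy_flat_add {W : Torus d L → ℝ} (hW : IsPotential W) (β : ℝ) {f : Torus d L → ℝ}
    (hf : MemLp f 4) (hf0 : ∫ x, f x = 0) :
    energy W β (fun x => flatDensity d L + f x) = energy W β (fun _ => flatDensity d L) +
      (β⁻¹ / 3 * (6 * flatDensity d L ^ 2 * (∫ x, f x ^ 2) +
        4 * flatDensity d L * (∫ x, f x ^ 3) + ∫ x, f x ^ 4) +
          1 / 2 * ∫ x, f x * conv W f x) := by
  have h := energy_line hW β (isDensity_flat (d := d) (L := L)).memLp hf 1
  simp only [one_mul] at h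
  rw [h]
  -- The linear terms vanish: f has mean zero and W convolved with a constant is zero.
  simp only [integral_const_mul, conv_const hW, hf0, mul_zero, integral_zero]
  ring

/-! ### Measures and densities -/

lemma freeEnergy_of_finite {W : Torus d L → ℝ} {β : ℝ} {ρ : ProbabilityMeasure (Torus d L)}
    (h : (ρ : Measure (Torus d L)) ≪ volume ∧ MemLp (density ρ) 4) :
    freeEnergy W 4 β ρ = (energy W β (density ρ) : ℝ) := by
  have h4 : ENNReal.ofReal 4 = 4 := by norm_num
  rw [freeEnergy, h4, if_pos h, energy]
  have e1 : ∀ x, density ρ x ^ (4 : ℝ) = density ρ x ^ 4 := fun x => by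
    exact_mod_cast Real.rpow_natCast (density ρ x) 4
  have e2 : ∀ x, ∫ y, W (x - y) * density ρ x * density ρ y =
      density ρ x * conv W (density ρ) x := fun x => by
    rw [conv, ← integral_const_mul]
    congr 1; ext y; ring
  simp only [e1, e2]
  norm_num

lemma freeEnergy_lt_top_iff {W : Torus d L → ℝ} {β : ℝ} {ρ : ProbabilityMeasure (Torus d L)} :
    freeEnergy W 4 β ρ < ⊤ ↔ (ρ : Measure (Torus d L)) ≪ volume ∧ MemLp (density ρ) 4 := by
  constructor
  · intro h
    by_contra h'
    have h4 : ENNReal.ofReal 4 = 4 := by norm_num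
    rw [freeEnergy, h4, if_neg h'] at h
    exact lt_irrefl _ h
  · intro h
    rw [freeEnergy_of_finite h]
    exact EReal.coe_lt_top _

lemma isDensity_density {ρ : ProbabilityMeasure (Torus d L)}
    (h : (ρ : Measure (Torus d L)) ≪ volume ∧ MemLp (density ρ) 4) : IsDensity (density ρ) where
  memLp := h.2
  nonneg := ae_of_all _ fun _ => ENNReal.toReal_nonneg
  integral_eq := by
    have := Measure.integral_toReal_rnDeriv h.1
    unfold density
    rw [this, probReal_univ]

lemma exists_probabilityMeasure {f : Torus d L → ℝ} (hf : IsDensity f) :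
    ∃ ν : ProbabilityMeasure (Torus d L),
      ((ν : Measure (Torus d L)) ≪ volume ∧ MemLp (density ν) 4) ∧ density ν =ᵐ[volume] f := by
  have hm : AEMeasurable (fun x => ENNReal.ofReal (f x)) (volume : Measure (Torus d L)) :=
    hf.memLp.aestronglyMeasurable.aemeasurable.ennreal_ofReal
  have hp : IsProbabilityMeasure
      ((volume : Measure (Torus d L)).withDensity fun x => ENNReal.ofReal (f x)) := by
    constructor
    rw [withDensity_apply _ MeasurableSet.univ, Measure.restrict_univ,
      ← ofReal_integral_eq_lintegral_ofReal hf.integrable hf.nonneg, hf.integral_eq,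
      ENNReal.ofReal_one]
  have hd : density ⟨_, hp⟩ =ᵐ[volume] f := by
    filter_upwards [Measure.rnDeriv_withDensity₀ volume hm, hf.nonneg] with x hx hx0
    unfold density
    rw [ProbabilityMeasure.coe_mk, hx, ENNReal.toReal_ofReal hx0]
  exact ⟨⟨_, hp⟩, ⟨withDensity_absolutelyContinuous _ _, hf.memLp.ae_eq hd.symm⟩, hd⟩

lemma flatState_finite :
    ((flatState d L : Measure (Torus d L)) ≪ volume ∧ MemLp (density (flatState d L)) 4) ∧
      density (flatState d L) =ᵐ[volume] fun _ => flatDensity d L := by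
  have hd : density (flatState d L) =ᵐ[volume] fun _ => flatDensity d L := by
    filter_upwards [Measure.rnDeriv_withDensity (volume : Measure (Torus d L))
      (f := fun _ => ENNReal.ofReal (flatDensity d L)) measurable_const] with x hx
    unfold density flatState
    rw [ProbabilityMeasure.coe_mk, hx, ENNReal.toReal_ofReal (flatDensity_pos d L).le]
  exact ⟨⟨withDensity_absolutelyContinuous _ _, isDensity_flat.memLp.ae_eq hd.symm⟩, hd⟩

lemma eq_flatState {ρ : ProbabilityMeasure (Torus d L)}
    (h : (ρ : Measure (Torus d L)) ≪ volume)
    (hd : density ρ =ᵐ[volume] fun _ => flatDensity d L) : ρ = flatState d L := by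
  apply Subtype.ext
  change (ρ : Measure (Torus d L)) = (volume : Measure (Torus d L)).withDensity
    fun _ => ENNReal.ofReal (flatDensity d L)
  rw [← Measure.withDensity_rnDeriv_eq _ _ h]
  apply withDensity_congr_ae
  filter_upwards [hd, Measure.rnDeriv_lt_top (ρ : Measure (Torus d L)) volume] with x hx hx2
  rw [← hx, density, ENNReal.ofReal_toReal hx2.ne]

/-- The flat state is a competitor of finite energy. -/
lemma IsMinimiser.finite {W : Torus d L → ℝ} {β : ℝ} {ρ : ProbabilityMeasure (Torus d L)}
    (h : IsMinimiser W 4 β ρ) :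
    (ρ : Measure (Torus d L)) ≪ volume ∧ MemLp (density ρ) 4 :=
  freeEnergy_lt_top_iff.1 ((h (flatState d L)).trans_lt
    (freeEnergy_lt_top_iff.2 flatState_finite.1))

lemma IsMinimiser.energy_le {W : Torus d L → ℝ} {β : ℝ} {ρ : ProbabilityMeasure (Torus d L)}
    (h : IsMinimiser W 4 β ρ) {f : Torus d L → ℝ} (hf : IsDensity f) :
    energy W β (density ρ) ≤ energy W β f := by
  obtain ⟨ν, hν, hνf⟩ := exists_probabilityMeasure hf
  have := h ν
  rw [freeEnergy_of_finite h.finite, freeEnergy_of_finite hν, EReal.coe_le_coe_iff] at this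
  rwa [energy_congr hνf] at this

lemma isMinimiser_flatState {W : Torus d L → ℝ} {β : ℝ}
    (h : ∀ f, IsDensity f → energy W β (fun _ => flatDensity d L) ≤ energy W β f) :
    IsMinimiser W 4 β (flatState d L) := by
  intro ν
  by_cases hν : (ν : Measure (Torus d L)) ≪ volume ∧ MemLp (density ν) 4
  · rw [freeEnergy_of_finite flatState_finite.1, freeEnergy_of_finite hν, EReal.coe_le_coe_iff,
      energy_congr flatState_finite.2]
    exact h _ (isDensity_density hν)
  · have : freeEnergy W 4 β ν = ⊤ := by
      by_contra h'
      exact hν (freeEnergy_lt_top_iff.1 (lt_top_iff_ne_top.2 h'))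
    rw [this]; exact le_top

/-! ### Instability of the flat state -/

/-- Used on energy expansions divided by their lowest power of t, letting t → 0⁺. -/
lemma nonneg_of_forall_small {a b c e T : ℝ} (hT : 0 < T)
    (h : ∀ t, 0 < t → t ≤ T → 0 ≤ a + b * t + c * t ^ 2 + e * t ^ 3) : 0 ≤ a := by
  have hc : Tendsto (fun t : ℝ => a + b * t + c * t ^ 2 + e * t ^ 3) (𝓝[>] 0) (𝓝 a) := by
    have : Continuous fun t : ℝ => a + b * t + c * t ^ 2 + e * t ^ 3 := by fun_prop
    simpa using (this.tendsto 0).mono_left nhdsWithin_le_nhds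
  refine ge_of_tendsto hc ?_
  filter_upwards [Ioc_mem_nhdsGT hT] with t ht
  exact h t ht.1 ht.2

/-- The plane wave `x ↦ cos (2 π k · x / L)`. -/
def planeWave (k : Fin d → ℕ) (x : Torus d L) : ℝ := (torusChar (natMode k) x).re

lemma continuous_planeWave (k : Fin d → ℕ) : Continuous (planeWave (L := L) k) :=
  Complex.continuous_re.comp (torusChar (natMode k)).continuous

lemma abs_planeWave_le (k : Fin d → ℕ) (x : Torus d L) : |planeWave k x| ≤ 1 :=
  (Complex.abs_re_le_norm _).trans (norm_torusChar _ _).le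

lemma integral_torusChar_re {n : Fin d → ℤ} (hn : n ≠ 0) :
    ∫ x : Torus d L, (torusChar n x).re = 0 := by
  have h := integral_re (Continuous.integrable_torus (torusChar (L := L) n).continuous)
  rw [integral_torusChar, if_neg hn] at h
  exact h.trans (by simp)

lemma natMode_ne_zero {k : Fin d → ℕ} (hk : k ≠ 0) : natMode k ≠ 0 := by
  intro h
  refine hk (funext fun i => ?_)
  have := congrFun h i
  simpa [natMode] using this

lemma integral_planeWave_sq {k : Fin d → ℕ} (hk : k ≠ 0) :
    ∫ x : Torus d L, planeWave k x ^ 2 = L ^ d / 2 := by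
  have e : ∀ x : Torus d L, planeWave k x ^ 2 =
      1 / 2 + 1 / 2 * (torusChar (natMode k + natMode k) x).re := fun x => by
    have h1 : (torusChar (natMode k) x).re ^ 2 + (torusChar (natMode k) x).im ^ 2 = 1 := by
      have := norm_torusChar (natMode k) x
      rw [← Complex.normSq_add_mul_I, Complex.re_add_im, Complex.normSq_eq_norm_sq, this]; norm_num
    rw [planeWave, torusChar_add, ContinuousMap.mul_apply, Complex.mul_re]
    linarith
  have h2 : natMode k + natMode k ≠ 0 := by
    rw [← two_nsmul]
    exact smul_ne_zero two_ne_zero (natMode_ne_zero hk)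
  have hi : Integrable fun x : Torus d L => (torusChar (natMode k + natMode k) x).re :=
    Continuous.integrable_torus (Complex.continuous_re.comp (torusChar _).continuous)
  simp only [e]
  rw [integral_add (integrable_const _) (hi.const_mul _), integral_const_mul,
    integral_torusChar_re h2, integral_const, volume_torus_real, smul_eq_mul]
  ring

lemma conv_planeWave {W : Torus d L → ℝ} (hW : IsPotential W) (k : Fin d → ℕ) (x : Torus d L) :
    conv W (planeWave k) x = symbol W (natMode k) * planeWave k x := by
  have h : ∫ y, (W (x - y) : ℂ) * torusChar (natMode k) y =
      symbol W (natMode k) * torusChar (natMode k) x := by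
    have hs : symbol W (natMode k) = symbol W (-natMode k) := by
      have : absMode (natMode k) = absMode (-natMode k) := by ext i; simp [absMode]
      rw [symbol, symbol, this]
    rw [hs, ← hW.fourierInt_eq, fourierInt, neg_neg, ← integral_mul_const,
      ← integral_sub_right_eq_self (fun y => (W y : ℂ) * torusChar (natMode k) y *
        torusChar (natMode k) x) x]
    congr 1; ext y
    have : torusChar (natMode k) y = torusChar (natMode k) (y - x) * torusChar (natMode k) x := by
      rw [← torusChar_add_arg, sub_add_cancel]
    rw [this, ← hW.neg (x - y), neg_sub]; ring
  have hc : Continuous fun y => (W (x - y) : ℂ) * torusChar (natMode k) y := by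
    have := hW.cont
    fun_prop
  have h2 := integral_re (Continuous.integrable_torus hc)
  rw [h] at h2
  have e3 : ∀ y, RCLike.re ((W (x - y) : ℂ) * torusChar (natMode k) y) =
      W (x - y) * planeWave k y := fun y => Complex.re_ofReal_mul _ _
  simp only [e3] at h2
  exact h2.trans (Complex.re_ofReal_mul _ _)

/-- If the flat density is minimal then it is linearly stable. -/
lemma linear_stability {W : Torus d L → ℝ} (hW : IsPotential W) {β : ℝ} {k : Fin d → ℕ}
    (hk : k ≠ 0)
    (h : ∀ f, IsDensity f → energy W β (fun _ => flatDensity d L) ≤ energy W β f) :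
    0 ≤ 4 * β⁻¹ * flatDensity d L ^ 2 + symbol W (natMode k) := by
  have hr := flatDensity_pos d L
  have hM := pow_pos hL.out d
  have mφ : MemLp (planeWave (L := L) k) 4 := memLp_of_continuous (continuous_planeWave k) 4
  have h0 : ∫ x : Torus d L, planeWave k x = 0 := integral_torusChar_re (natMode_ne_zero hk)
  -- The wave is bounded by 1, so amplitudes up to r keep the density nonnegative.
  have hd : ∀ t, 0 < t → t ≤ flatDensity d L →
      IsDensity fun x : Torus d L => flatDensity d L + t * planeWave k x := by
    intro t ht htr
    refine ⟨isDensity_flat.memLp.add (mφ.const_mul t), ae_of_all _ fun x => ?_, ?_⟩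
    · have := (abs_le.1 (abs_planeWave_le k x)).1
      nlinarith
    · rw [integral_add (integrable_const _) ((mφ.integrable (by norm_num)).const_mul t),
        integral_const_mul, h0, isDensity_flat.integral_eq]
      ring
  -- The first variation vanishes, so the excess is divided by t² and a is the second variation.
  have key := nonneg_of_forall_small (a := 2 * β⁻¹ * (∫ x : Torus d L, flatDensity d L ^ 2 *
      planeWave k x ^ 2) + 1 / 2 * ∫ x, planeWave k x * conv W (planeWave k) x)
    (b := 4 * β⁻¹ / 3 * ∫ x : Torus d L, flatDensity d L * planeWave k x ^ 3)
    (c := β⁻¹ / 3 * ∫ x : Torus d L, planeWave k x ^ 4) (e := 0) hr (fun t ht htr => by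
      have h1 := h _ (hd t ht htr)
      rw [energy_line hW β isDensity_flat.memLp mφ t] at h1
      simp only [integral_const_mul, conv_const hW, h0, mul_zero, integral_zero] at h1 ⊢
      have ht2 : 0 < t ^ 2 := by positivity
      refine nonneg_of_mul_nonneg_right ?_ ht2
      linarith)
  have e : ∀ x : Torus d L, planeWave k x * conv W (planeWave k) x =
      symbol W (natMode k) * planeWave k x ^ 2 := fun x => by rw [conv_planeWave hW]; ring
  simp only [e, integral_const_mul, integral_planeWave_sq hk] at key
  -- The second variation is this factor times L^d/4, since ∫ cos² = L^d/2.
  refine nonneg_of_mul_nonneg_right (b := 4 * β⁻¹ * flatDensity d L ^ 2 + symbol W (natMode k))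
    (a := L ^ d / 4) ?_ (by positivity)
  linarith

/-! ### The Euler–Lagrange conditions -/

lemma volume_torus_ne_zero : (volume : Measure (Torus d L)) ≠ 0 := by
  intro h
  have := volume_torus_univ (d := d) (L := L)
  rw [h, Measure.coe_zero, Pi.zero_apply] at this
  exact (ENNReal.ofReal_pos.2 (pow_pos hL.out d)).ne this

lemma IsDensity.line {f g : Torus d L → ℝ} (hf : IsDensity f) (hg : IsDensity g) {t : ℝ}
    (ht : 0 ≤ t) (ht1 : t ≤ 1) : IsDensity fun x => f x + t * (g x - f x) where
  memLp := hf.memLp.add ((hg.memLp.sub hf.memLp).const_mul t)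
  nonneg := by
    filter_upwards [hf.nonneg, hg.nonneg] with x h1 h2
    nlinarith
  integral_eq := by
    have hi : Integrable fun x => g x - f x := hg.integrable.sub hf.integrable
    rw [integral_add hf.integrable (hi.const_mul t),
      integral_const_mul, integral_sub hg.integrable hf.integrable, hf.integral_eq, hg.integral_eq]
    ring

/-- The first variation of the free energy. -/
def chemicalPotential (W : Torus d L → ℝ) (β : ℝ) (f : Torus d L → ℝ) (x : Torus d L) : ℝ :=
  4 * β⁻¹ / 3 * f x ^ 3 + conv W f x

lemma hasInt_chemicalPotential_mul {W f g : Torus d L → ℝ} (hW : Continuous W) (β : ℝ)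
    (hf : MemLp f 4) (hg : MemLp g 4) :
    HasInt (fun x => chemicalPotential W β f x * g x)
      (4 * β⁻¹ / 3 * (∫ x, f x ^ 3 * g x) + ∫ x, g x * conv W f x) := by
  have h1 := integrable_pow_mul_pow hf hg (a := 3) (b := 1) (by norm_num)
  simp only [pow_one] at h1
  have h2 := integrable_mul_conv hW (hg.integrable (by norm_num)) (hf.integrable (by norm_num))
  refine (((Integrable.hasInt h1).mul (4 * β⁻¹ / 3)).add (Integrable.hasInt h2)).congr
    (fun x => ?_) rfl
  rw [chemicalPotential]; ring

/-- Densities form a convex set: the one-sided derivative of the energy from f towards g is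
nonnegative. -/
lemma first_variation {W : Torus d L → ℝ} (hW : IsPotential W) {β : ℝ} {f : Torus d L → ℝ}
    (hf : IsDensity f) (hmin : ∀ g, IsDensity g → energy W β f ≤ energy W β g)
    {g : Torus d L → ℝ} (hg : IsDensity g) :
    ∫ x, chemicalPotential W β f x * f x ≤ ∫ x, chemicalPotential W β f x * g x := by
  have mδ : MemLp (fun x => g x - f x) 4 := hg.memLp.sub hf.memLp
  have key := nonneg_of_forall_small (T := 1)
    (a := 4 * β⁻¹ / 3 * (∫ x, f x ^ 3 * (g x - f x)) + ∫ x, (g x - f x) * conv W f x)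
    (b := 2 * β⁻¹ * (∫ x, f x ^ 2 * (g x - f x) ^ 2) +
      1 / 2 * ∫ x, (g x - f x) * conv W (fun x => g x - f x) x)
    (c := 4 * β⁻¹ / 3 * ∫ x, f x * (g x - f x) ^ 3)
    (e := β⁻¹ / 3 * ∫ x, (g x - f x) ^ 4) one_pos (fun t ht ht1 => by
    have h1 := hmin _ (hf.line hg ht.le ht1)
    rw [energy_line hW β hf.memLp mδ t] at h1
    refine nonneg_of_mul_nonneg_right (a := t) ?_ ht
    have e : ∀ a b c e : ℝ, t * (a + b * t + c * t ^ 2 + e * t ^ 3) =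
        t * a + t ^ 2 * b + t ^ 3 * c + t ^ 4 * e := by intros; ring
    rw [e]
    linarith)
  rw [← (hasInt_chemicalPotential_mul hW.cont β hf.memLp mδ).2] at key
  simp only [mul_sub] at key
  rw [integral_sub (hasInt_chemicalPotential_mul hW.cont β hf.memLp hg.memLp).1
    (hasInt_chemicalPotential_mul hW.cont β hf.memLp hf.memLp).1] at key
  linarith

lemma isDensity_indicator {s : Set (Torus d L)} (hs : MeasurableSet s)
    (h0 : volume.real s ≠ 0) :
    IsDensity (s.indicator fun _ => (volume.real s)⁻¹) where
  memLp := (memLp_const _).indicator hs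
  nonneg := ae_of_all _ fun x => Set.indicator_nonneg (fun _ _ => by positivity) x
  integral_eq := by
    rw [integral_indicator hs, setIntegral_const, smul_eq_mul, mul_inv_cancel₀ h0]

/-- The Euler–Lagrange conditions for a minimising density. -/
lemma euler_lagrange {W : Torus d L → ℝ} (hW : IsPotential W) {β : ℝ} {f : Torus d L → ℝ}
    (hf : IsDensity f) (hmin : ∀ g, IsDensity g → energy W β f ≤ energy W β g) :
    ∃ c, ∀ᵐ x, c ≤ chemicalPotential W β f x ∧ (f x = 0 ∨ chemicalPotential W β f x = c) := by
  -- The multiplier can only be this f-weighted mean, since the potential must equal c wherever f >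
  -- 0.
  set c := ∫ x, chemicalPotential W β f x * f x with hc
  have hμ : Integrable (chemicalPotential W β f) := by
    have := (hasInt_chemicalPotential_mul hW.cont β hf.memLp (memLp_const (1 : ℝ))).1
    simpa using this
  -- Testing with normalised indicators bounds c by the mean of the potential over every set of
  -- positive measure.
  have h1 : (fun _ => c) ≤ᵐ[volume] chemicalPotential W β f := by
    refine ae_le_of_forall_setIntegral_le (integrable_const c) hμ fun s hs _ => ?_
    rw [setIntegral_const, smul_eq_mul]
    by_cases h0 : volume.real s = 0
    · rw [h0, zero_mul, Measure.restrict_eq_zero.2, integral_zero_measure]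
      exact (measureReal_eq_zero_iff).1 h0
    · have h := first_variation hW hf hmin (isDensity_indicator hs h0)
      have e : ∀ x, chemicalPotential W β f x * s.indicator (fun _ => (volume.real s)⁻¹) x =
          s.indicator (fun x => chemicalPotential W β f x * (volume.real s)⁻¹) x := fun x => by
        by_cases hx : x ∈ s <;> simp [hx]
      simp only [e] at h
      rw [integral_indicator hs, integral_mul_const, ← div_eq_mul_inv,
        le_div_iff₀ (lt_of_le_of_ne measureReal_nonneg (Ne.symm h0))] at h
      linarith
  -- A nonnegative product whose integral is c - c = 0.
  have h2 : (fun x => (chemicalPotential W β f x - c) * f x) =ᵐ[volume] 0 := by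
    have hi := (hasInt_chemicalPotential_mul hW.cont β hf.memLp hf.memLp).1
    have hi2 := hf.integrable.const_mul c
    have hi3 : Integrable fun x => (chemicalPotential W β f x - c) * f x := by
      simp only [sub_mul]; exact hi.sub hi2
    rw [← integral_eq_zero_iff_of_nonneg_ae _ hi3]
    · simp only [sub_mul]
      rw [integral_sub hi hi2, integral_const_mul, hf.integral_eq, mul_one, sub_self]
    · filter_upwards [h1, hf.nonneg] with x hx1 hx2
      exact mul_nonneg (sub_nonneg.2 hx1) hx2
  refine ⟨c, ?_⟩
  filter_upwards [h1, h2] with x hx1 hx2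
  refine ⟨hx1, ?_⟩
  rcases mul_eq_zero.1 hx2 with h | h
  · exact Or.inr (sub_eq_zero.1 h)
  · exact Or.inl h

/-- A minimising density that is `L¹`-close to the flat density is uniformly close to it. -/
lemma minimiser_uniform_bound {W : Torus d L → ℝ} (hW : IsPotential W) {β : ℝ} (hβ : 0 < β)
    {f : Torus d L → ℝ} (hf : IsDensity f)
    (hmin : ∀ g, IsDensity g → energy W β f ≤ energy W β g) {C : ℝ} (hC : ∀ x, |W x| ≤ C) :
    ∀ᵐ x, |f x - flatDensity d L| ≤
      3 * β / 2 * (C * ∫ y, |f y - flatDensity d L|) / flatDensity d L ^ 2 := by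
  have hr := flatDensity_pos d L
  set r := flatDensity d L with hrdef
  obtain ⟨c, hc⟩ := euler_lagrange hW hf hmin
  have hη : Integrable fun y => f y - r := hf.integrable.sub (integrable_const r)
  set ε := C * ∫ y, |f y - r| with hε
  -- W annihilates constants, so only f - r contributes.
  have hconv : ∀ x, |conv W f x| ≤ ε := by
    intro x
    have e : conv W f x = conv W (fun y => f y - r) x := by
      have h := conv_add hW.cont hη (integrable_const r) x
      rw [conv_const hW, add_zero] at h
      rw [← h]; simp only [sub_add_cancel]
    rw [e]
    exact abs_conv_le hC hη x
  have hgood : ∀ᵐ x, 0 ≤ f x ∧ c - ε ≤ 4 * β⁻¹ / 3 * f x ^ 3 ∧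
      (f x = 0 ∨ 4 * β⁻¹ / 3 * f x ^ 3 ≤ c + ε) := by
    filter_upwards [hc, hf.nonneg] with x hx hx0
    have h := abs_le.1 (hconv x)
    unfold chemicalPotential at hx
    refine ⟨hx0, by linarith [hx.1], hx.2.imp id fun h' => by linarith⟩
  -- Equality in Euler–Lagrange is needed only at the larger value a > 0; at b the inequality
  -- suffices, so a possible zero set of f does no harm.
  have hdiff : ∀ a b : ℝ, 0 < a → c - ε ≤ 4 * β⁻¹ / 3 * b ^ 3 →
      (a = 0 ∨ 4 * β⁻¹ / 3 * a ^ 3 ≤ c + ε) → a ^ 3 - b ^ 3 ≤ 3 * β / 2 * ε := by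
    intro a b ha hb ha'
    have h := ha'.resolve_left ha.ne'
    have : 4 * β⁻¹ / 3 * (a ^ 3 - b ^ 3) ≤ 2 * ε := by linarith
    rw [← le_div_iff₀' (by positivity)] at this
    refine this.trans (le_of_eq ?_)
    field_simp
    ring
  have havg : ⨍ x, f x = r := by
    rw [average_eq, hf.integral_eq, volume_torus_real, smul_eq_mul, mul_one, hrdef, flatDensity]
  -- As r is the mean of f, there are good points with values at most r and at least r to compare
  -- with.
  obtain ⟨y₁, hy₁, hy₁r⟩ := exists_notMem_null_le_average volume_torus_ne_zero hf.integrable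
    (ae_iff.1 hgood)
  obtain ⟨y₂, hy₂, hy₂r⟩ := exists_notMem_null_average_le volume_torus_ne_zero hf.integrable
    (ae_iff.1 hgood)
  rw [havg] at hy₁r hy₂r
  have hy₁ := not_not.1 hy₁
  have hy₂ := not_not.1 hy₂
  filter_upwards [hgood] with x hx
  rw [le_div_iff₀ (by positivity)]
  have hx0 := hx.1
  rcases le_total r (f x) with h | h
  · rw [abs_of_nonneg (sub_nonneg.2 h)]
    have h1 := hdiff (f x) (f y₁) (hr.trans_le h) hy₁.2.1 hx.2.2
    have h2 : f y₁ ^ 3 ≤ r ^ 3 := pow_le_pow_left₀ hy₁.1 hy₁r 3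
    -- The bound on cubes passes to f through |f³ - r³| ≥ r²|f - r|.
    nlinarith [mul_nonneg (sub_nonneg.2 h) (by positivity : 0 ≤ f x ^ 2 + f x * r)]
  · rw [abs_of_nonpos (sub_nonpos.2 h)]
    have h1 := hdiff (f y₂) (f x) (hr.trans_le hy₂r) hx.2.1 hy₂.2.2
    have h2 : r ^ 3 ≤ f y₂ ^ 3 := pow_le_pow_left₀ hr.le hy₂r 3
    nlinarith [mul_nonneg (sub_nonneg.2 h) (by positivity : 0 ≤ f x ^ 2 + f x * r)]

/-! ### Consequences of coercivity -/

/-- Only the entropy carries β: split β⁻¹ = b + (β⁻¹ - b) and apply `coercivity` to the first part.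
-/
lemma excess_lower_bound {W : Torus d L → ℝ} (hW : IsPotential W) {k : Fin d → ℕ} (hk : k ≠ 0)
    {b : ℝ} (hb : 0 ≤ b) (hgap : SpectralGap W k (4 * flatDensity d L ^ 2 * b)) (β : ℝ)
    {f : Torus d L → ℝ} (hf : IsDensity f) :
    energy W β (fun _ => flatDensity d L) + b / 72 * (∫ x, (f x - flatDensity d L) ^ 4) +
      (β⁻¹ - b) / 3 * (∫ x, (6 * flatDensity d L ^ 2 * (f x - flatDensity d L) ^ 2 +
        4 * flatDensity d L * (f x - flatDensity d L) ^ 3 + (f x - flatDensity d L) ^ 4)) ≤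
      energy W β f := by
  set r := flatDensity d L with hr
  set η : Torus d L → ℝ := fun x => f x - r with hη
  have mη : MemLp η 4 := hf.memLp.sub (memLp_const r)
  have h0 : ∫ x, η x = 0 := by
    rw [hη, integral_sub hf.integrable (integrable_const r), hf.integral_eq,
      isDensity_flat.integral_eq, sub_self]
  have e1 : energy W β f = energy W β fun x => r + η x := by
    congr 1; ext x; simp [hη]
  have e2 := (((Integrable.hasInt (integrable_pow mη (a := 2) (by norm_num))).mul (6 * r ^ 2)).add
    ((Integrable.hasInt (integrable_pow mη (a := 3) (by norm_num))).mul (4 * r))).add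
    (Integrable.hasInt (integrable_pow_four mη))
  have key := coercivity hW hk hb hgap mη h0 (hf.nonneg.mono fun x hx => by
    change 0 ≤ f x - r + r
    rwa [sub_add_cancel])
  rw [e1, energy_flat_add hW β mη h0, e2.2]
  rw [← hr] at key ⊢
  linarith

/-- The polynomial is x²((x + 2r)² + 2r²). -/
lemma entropy_nonneg (r x : ℝ) : 0 ≤ 6 * r ^ 2 * x ^ 2 + 4 * r * x ^ 3 + x ^ 4 := by
  nlinarith [sq_nonneg (x ^ 2 + 2 * r * x), sq_nonneg (r * x)]

/-- The difference is (x² - 2rx)² + 2x⁴ - 10r²x² + 13r⁴, and the last three terms form a positive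
quadratic form in x², r². -/
lemma entropy_le (r x : ℝ) : 6 * r ^ 2 * x ^ 2 + 4 * r * x ^ 3 + x ^ 4 ≤ 13 * r ^ 4 + 4 * x ^ 4 := by
  nlinarith [sq_nonneg (x ^ 2 - 2 * r * x), sq_nonneg (3 * r ^ 2 - x ^ 2),
    sq_nonneg (2 * r ^ 2 - x ^ 2)]

/-- The entropy correction has the favourable sign, so the excess dominates (b/72)∫(f - r)⁴, which
vanishes only for the flat density. -/
lemma unique_minimiser_of_le {W : Torus d L → ℝ} (hW : IsPotential W) {k : Fin d → ℕ} (hk : k ≠ 0)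
    {b : ℝ} (hb : 0 < b) (hgap : SpectralGap W k (4 * flatDensity d L ^ 2 * b)) {β : ℝ}
    (hβ : b ≤ β⁻¹) : IsUniqueMinimiser W 4 β (flatState d L) := by
  have hlow : ∀ f : Torus d L → ℝ, IsDensity f → energy W β (fun _ => flatDensity d L) +
      b / 72 * (∫ x, (f x - flatDensity d L) ^ 4) ≤ energy W β f := by
    intro f hf
    have h1 := excess_lower_bound hW hk hb.le hgap β hf
    have h2 := mul_nonneg (by linarith : 0 ≤ (β⁻¹ - b) / 3) (integral_nonneg (μ := volume) fun x =>
      entropy_nonneg (flatDensity d L) (f x - flatDensity d L))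
    linarith
  have hI : ∀ f : Torus d L → ℝ, 0 ≤ ∫ x, (f x - flatDensity d L) ^ 4 := fun f =>
    integral_nonneg fun x => by positivity
  refine ⟨isMinimiser_flatState fun f hf => ?_, fun ν hν => ?_⟩
  · have h1 := hlow f hf
    have h2 := mul_nonneg (by positivity : 0 ≤ b / 72) (hI f)
    linarith
  · have hd := isDensity_density hν.finite
    have h1 := hlow _ hd
    have h2 := hν.energy_le isDensity_flat
    have h3 : ∫ x, (density ν x - flatDensity d L) ^ 4 = 0 := by
      refine le_antisymm ?_ (hI _)
      by_contra! h
      have := mul_pos (by positivity : 0 < b / 72) h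
      linarith
    have hi : Integrable fun x => (density ν x - flatDensity d L) ^ 4 :=
      integrable_pow_four (hd.memLp.sub (memLp_const _))
    rw [integral_eq_zero_iff_of_nonneg (fun x => by positivity) hi] at h3
    refine eq_flatState hν.finite.1 (h3.mono fun x hx => ?_)
    exact sub_eq_zero.1 (pow_eq_zero_iff (by norm_num : 4 ≠ 0) |>.1 hx)

/-- Minimisers are close in `L⁴` to the flat density when `β` is close to the critical value. -/
lemma minimiser_L4_bound {W : Torus d L → ℝ} (hW : IsPotential W) {k : Fin d → ℕ} (hk : k ≠ 0)
    {b : ℝ} (hb : 0 < b) (hgap : SpectralGap W k (4 * flatDensity d L ^ 2 * b)) {β : ℝ}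
    (hβ : β⁻¹ ≤ b) (hβ' : 4 * ((b - β⁻¹) / 3) ≤ b / 144) {f : Torus d L → ℝ} (hf : IsDensity f)
    (hmin : energy W β f ≤ energy W β fun _ => flatDensity d L) :
    b / 144 * (∫ x, (f x - flatDensity d L) ^ 4) ≤
      13 * flatDensity d L ^ 3 * ((b - β⁻¹) / 3) := by
  set r := flatDensity d L with hr
  have mη : MemLp (fun x => f x - r) 4 := hf.memLp.sub (memLp_const r)
  have h1 := excess_lower_bound hW hk hb.le hgap β hf
  rw [← hr] at h1
  have hi := integrable_pow_four mη
  have hA : ∫ x, (6 * r ^ 2 * (f x - r) ^ 2 + 4 * r * (f x - r) ^ 3 + (f x - r) ^ 4) ≤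
      13 * r ^ 3 + 4 * ∫ x, (f x - r) ^ 4 := by
    have e : ∫ x : Torus d L, (13 * r ^ 4 + 4 * (f x - r) ^ 4) =
        13 * r ^ 3 + 4 * ∫ x, (f x - r) ^ 4 := by
      -- The volume is 1/r.
      have hM : L ^ d * (13 * r ^ 4) = 13 * r ^ 3 := by
        have := (pow_pos hL.out d).ne'
        rw [hr, flatDensity]
        field_simp
      rw [integral_add (integrable_const _) (hi.const_mul 4), integral_const, volume_torus_real,
        smul_eq_mul, hM, integral_const_mul]
    rw [← e]
    refine integral_mono ?_ ((integrable_const _).add (hi.const_mul 4)) fun x => entropy_le r _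
    exact (((integrable_pow mη (a := 2) (by norm_num)).const_mul _).add
      ((integrable_pow mη (a := 3) (by norm_num)).const_mul _)).add hi
  have hI : 0 ≤ ∫ x, (f x - r) ^ 4 := integral_nonneg fun x => by positivity
  have h2 := mul_le_mul_of_nonneg_left hA (by linarith : 0 ≤ (b - β⁻¹) / 3)
  -- The quartic part of the entropy is absorbed by half of the coercivity constant b/72.
  have h3 := mul_le_mul_of_nonneg_right hβ' hI
  linarith

/-- Pointwise |y| ≤ θ + θ⁻³y⁴, by splitting at |y| = θ. -/
lemma integral_abs_le {f : Torus d L → ℝ} (hf : MemLp f 4) {θ : ℝ} (hθ : 0 < θ) :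
    ∫ x, |f x| ≤ L ^ d * θ + (θ ^ 3)⁻¹ * ∫ x, f x ^ 4 := by
  have hi := integrable_pow_four hf
  have e : ∫ x : Torus d L, (θ + (θ ^ 3)⁻¹ * f x ^ 4) =
      L ^ d * θ + (θ ^ 3)⁻¹ * ∫ x, f x ^ 4 := by
    rw [integral_add (integrable_const _) (hi.const_mul _), integral_const_mul, integral_const,
      volume_torus_real, smul_eq_mul]
  rw [← e]
  refine integral_mono (hf.integrable (by norm_num)).abs
    ((integrable_const _).add (hi.const_mul _)) fun x => ?_
  have h4 : f x ^ 4 = |f x| ^ 4 := (Even.pow_abs (by decide) _).symm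
  simp only [h4]
  rcases le_total |f x| θ with h | h
  · have : 0 ≤ (θ ^ 3)⁻¹ * |f x| ^ 4 := by positivity
    linarith
  · have h3 : θ ^ 3 ≤ |f x| ^ 3 := pow_le_pow_left₀ hθ.le h 3
    have : |f x| ≤ (θ ^ 3)⁻¹ * |f x| ^ 4 := by
      rw [le_inv_mul_iff₀ (by positivity)]
      nlinarith [mul_le_mul_of_nonneg_right h3 (abs_nonneg (f x))]
    linarith

/-- Minimisers converge uniformly to the flat density at the critical value. -/
theorem minimisers_tendsto {W : Torus d L → ℝ} (hW : IsPotential W) {k : Fin d → ℕ} (hk : k ≠ 0)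
    {b : ℝ} (hb : 0 < b) (hgap : SpectralGap W k (4 * flatDensity d L ^ 2 * b))
    (ρ : ℝ → ProbabilityMeasure (Torus d L)) (hρ : ∀ β, b⁻¹ < β → IsMinimiser W 4 β (ρ β)) :
    Tendsto (fun β => eLpNorm (fun x => density (ρ β) x - flatDensity d L) ∞ volume)
      (𝓝[>] b⁻¹) (𝓝 0) := by
  obtain ⟨C, hC0, hC⟩ := exists_bound_of_continuous hW.cont
  have hr := flatDensity_pos d L
  have hM := pow_pos hL.out d
  have hb' : 0 < b⁻¹ := inv_pos.2 hb
  have hδ : Tendsto (fun β : ℝ => (b - β⁻¹) / 3) (𝓝[>] b⁻¹) (𝓝 0) := by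
    have : ContinuousAt (fun β : ℝ => (b - β⁻¹) / 3) b⁻¹ := by
      have := hb'.ne'
      fun_prop (disch := assumption)
    have h := this.tendsto.mono_left (nhdsWithin_le_nhds (s := Set.Ioi b⁻¹))
    simpa using h
  rw [ENNReal.tendsto_nhds_zero]
  intro ε hε
  rcases eq_or_ne ε ⊤ with rfl | hε'
  · exact Eventually.of_forall fun _ => le_top
  have hε0 : 0 < ε.toReal := ENNReal.toReal_pos hε.ne' hε'
  -- The L¹ distance for which `minimiser_uniform_bound` yields ε when β < 2b⁻¹.
  set e := ε.toReal * flatDensity d L ^ 2 / (3 * b⁻¹ * C) with he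
  have he0 : 0 < e := by positivity
  -- Makes the constant part of `integral_abs_le` equal to e/2; the L⁴ bound supplies the other
  -- half.
  set θ := e / (2 * L ^ d) with hθ
  have hθ0 : 0 < θ := by positivity
  have ev1 : ∀ᶠ β in 𝓝[>] b⁻¹, (b - β⁻¹) / 3 < b / 144 / 4 :=
    hδ.eventually (gt_mem_nhds (by positivity))
  have ev2 : ∀ᶠ β in 𝓝[>] b⁻¹,
      (b - β⁻¹) / 3 < b / 144 * (e / 2 * θ ^ 3) / (13 * flatDensity d L ^ 3) :=
    hδ.eventually (gt_mem_nhds (by positivity))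
  filter_upwards [ev1, ev2, Ioo_mem_nhdsGT (by linarith : b⁻¹ < 2 * b⁻¹)] with β h1 h2 hβ
  have hβ0 : 0 < β := hb'.trans hβ.1
  have hd := isDensity_density (hρ β hβ.1).finite
  have hmin : ∀ g, IsDensity g → energy W β (density (ρ β)) ≤ energy W β g :=
    fun g hg => (hρ β hβ.1).energy_le hg
  have hβb : β⁻¹ ≤ b := by
    rw [inv_le_comm₀ hβ0 hb]; exact hβ.1.le
  have h4 := minimiser_L4_bound hW hk hb hgap hβb (by linarith) hd (hmin _ isDensity_flat)
  rw [lt_div_iff₀ (by positivity)] at h2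
  have h5 : ∫ x, (density (ρ β) x - flatDensity d L) ^ 4 ≤ e / 2 * θ ^ 3 := by
    refine le_of_mul_le_mul_left (h4.trans ?_) (by positivity : 0 < b / 144)
    linarith
  have h6 : ∫ x, |density (ρ β) x - flatDensity d L| ≤ e := by
    refine (integral_abs_le (hd.memLp.sub (memLp_const _)) hθ0).trans ?_
    have a1 : L ^ d * θ = e / 2 := by rw [hθ]; field_simp
    have a2 := mul_le_mul_of_nonneg_left h5 (by positivity : 0 ≤ (θ ^ 3)⁻¹)
    have a3 : (θ ^ 3)⁻¹ * (e / 2 * θ ^ 3) = e / 2 := by field_simp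
    simp only [Pi.sub_apply]
    linarith
  rw [eLpNorm_exponent_top, ← ENNReal.ofReal_toReal hε']
  refine eLpNormEssSup_le_of_ae_bound ?_
  filter_upwards [minimiser_uniform_bound hW hβ0 hd hmin hC] with x hx
  rw [Real.norm_eq_abs]
  refine hx.trans ?_
  rw [div_le_iff₀ (by positivity)]
  calc 3 * β / 2 * (C * ∫ y, |density (ρ β) y - flatDensity d L|)
      ≤ 3 * (2 * b⁻¹) / 2 * (C * e) := by
        have := hβ.2.le
        gcongr
    _ = ε.toReal * flatDensity d L ^ 2 := by
        rw [he]; field_simp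

/-! ### The critical parameter -/

lemma symbol_eq (W : Torus d L → ℝ) (n : Fin d → ℤ) :
    symbol W n = L ^ ((d : ℝ) / 2) *
      (coeff W (natMode (absMode n)) / Theta (natMode (absMode n))) := by
  rw [symbol, normConst, div_div_eq_mul_div, mul_div_assoc, mul_comm]
  ring

lemma absMode_natMode (k : Fin d → ℕ) : absMode (natMode k) = k := by
  ext i; simp [absMode, natMode]

/-- Modes with a sine factor have zero coefficient, so a negative one already lies in ℕ^d. -/
lemma exists_natMode_coeff_neg {W : Torus d L → ℝ} (hW : IsPotential W) (h : ¬ HStable W) :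
    ∃ k : Fin d → ℕ, coeff W (natMode k) < 0 := by
  unfold HStable at h
  push Not at h
  obtain ⟨k, -, hk⟩ := h
  have hpos : ∀ i, 0 ≤ k i := fun i => by
    by_contra! hi
    rw [hW.coeff_eq_zero k i hi] at hk
    exact lt_irrefl _ hk
  refine ⟨absMode k, ?_⟩
  have : natMode (absMode k) = k := by
    ext i; exact Int.natAbs_of_nonneg (hpos i)
  rwa [this]

lemma iInf_coeff_div_Theta {W : Torus d L → ℝ} {ks : Fin d → ℕ} (hks : ks ≠ 0)
    (hmin : ∀ k : Fin d → ℕ, k ≠ 0 → k ≠ ks → coeff W (natMode ks) / Theta (natMode ks) <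
      coeff W (natMode k) / Theta (natMode k)) :
    ⨅ k : {k : Fin d → ℕ // k ≠ 0}, coeff W (natMode k.1) / Theta (natMode k.1) =
      coeff W (natMode ks) / Theta (natMode ks) := by
  have hle : ∀ k : {k : Fin d → ℕ // k ≠ 0}, coeff W (natMode ks) / Theta (natMode ks) ≤
      coeff W (natMode k.1) / Theta (natMode k.1) := fun k => by
    by_cases h : k.1 = ks
    · rw [h]
    · exact (hmin k.1 k.2 h).le
  have : Nonempty {k : Fin d → ℕ // k ≠ 0} := ⟨⟨ks, hks⟩⟩
  have hbdd : BddBelow (Set.range fun k : {k : Fin d → ℕ // k ≠ 0} =>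
      coeff W (natMode k.1) / Theta (natMode k.1)) := by
    refine ⟨coeff W (natMode ks) / Theta (natMode ks), ?_⟩
    rintro _ ⟨k, rfl⟩
    exact hle k
  refine le_antisymm ?_ (le_ciInf hle)
  exact ciInf_le hbdd ⟨ks, hks⟩

/-- With s = L^(d/2): r = s⁻², r^(5/2) = s⁻⁵, and the symbol is s times Ŵ/Θ. -/
lemma betaSharp_four_eq {W : Torus d L → ℝ} {ks : Fin d → ℕ} (hks : ks ≠ 0)
    (hmin : ∀ k : Fin d → ℕ, k ≠ 0 → k ≠ ks → coeff W (natMode ks) / Theta (natMode ks) <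
      coeff W (natMode k) / Theta (natMode k)) :
    betaSharp W 4 = (-symbol W (natMode ks) / (4 * flatDensity d L ^ 2))⁻¹ := by
  have hs : 0 < L ^ ((d : ℝ) / 2) := Real.rpow_pos_of_pos hL.out _
  have hr : flatDensity d L = (L ^ ((d : ℝ) / 2))⁻¹ ^ 2 := by
    rw [flatDensity, inv_pow, rpow_half_sq]
  have h5 : flatDensity d L ^ ((4 : ℝ) - 3 / 2) = (L ^ ((d : ℝ) / 2))⁻¹ ^ 5 := by
    rw [hr, ← Real.rpow_natCast _ 2, ← Real.rpow_mul (inv_pos.2 hs).le, ← Real.rpow_natCast _ 5]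
    norm_num
  rw [betaSharp, iInf_coeff_div_Theta hks hmin, h5, symbol_eq, absMode_natMode, hr]
  set w := coeff W (natMode ks) / Theta (natMode ks)
  -- For w = 0 both sides are 0 by the convention for division.
  by_cases hw : w = 0
  · simp [hw]
  · field_simp

/-- The symbol depends only on the coordinatewise absolute value of a mode, so conditions on ℕ^d
transfer to ℤ^d; trivial signs already give the required constants. -/
lemma spectralGap {W : Torus d L → ℝ} {ks : Fin d → ℕ} (hks : ks ≠ 0)
    (hneg : coeff W (natMode ks) < 0) (hnonneg : ∀ k, k ≠ ks → 0 ≤ coeff W (natMode k))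
    (h2 : ∀ j ∈ P2 ks, 6 * Theta (natMode j) ^ 5 * c2 L ks 1 1 j ^ 2 *
      ((P2 ks ∪ P3 ks).card : ℝ) / (flatDensity d L * Theta (natMode ks)) *
        |coeff W (natMode ks)| < coeff W (natMode j))
    (h3 : ∀ l ∈ P3 ks, 2 * Theta (natMode l) ^ 9 * Theta (natMode ks) * c3 L ks 1 1 1 l ^ 2 *
      ((P2 ks ∪ P3 ks).card : ℝ) / (3 * flatDensity d L ^ 2) * |coeff W (natMode ks)| <
        coeff W (natMode l)) :
    SpectralGap W ks (-symbol W (natMode ks)) := by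
  have hs : 0 < L ^ ((d : ℝ) / 2) := Real.rpow_pos_of_pos hL.out _
  have hκ : -symbol W (natMode ks) =
      L ^ ((d : ℝ) / 2) * (|coeff W (natMode ks)| / Theta (natMode ks)) := by
    rw [symbol_eq, absMode_natMode, abs_of_neg hneg]; ring
  refine ⟨fun n hn => ?_, fun n hn => ?_, fun n hn => ?_, fun n hn => ?_⟩
  · exact div_nonneg (hnonneg _ fun h => hn (mem_modes_of_absMode_eq h)) (normConst_pos _).le
  · rw [neg_neg, symbol, symbol, absMode_natMode, absMode_eq_of_mem_modes hn]
  · have hj := absMode_mem_P2 hn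
    rw [hκ, symbol_eq, mul_left_comm]
    exact mul_le_mul_of_nonneg_left (second_harmonic_bound hks hj (h2 _ hj)) hs.le
  · have hl := absMode_mem_P3 hn
    rw [hκ, symbol_eq, mul_left_comm]
    exact mul_le_mul_of_nonneg_left (third_harmonic_bound hks hl (h3 _ hl)) hs.le

end

end PorousTransition

/-! ### Locating the transition point and proving its continuity -/

theorem theorem5p19 {d : ℕ} {L : ℝ} [Fact (0 < L)]
    (W : PorousTransition.Torus d L → ℝ) (hW : PorousTransition.IsPotential W)
    (hWs : ¬ PorousTransition.HStable W)
    (βc : ℝ) (hβc : PorousTransition.IsTransitionPoint W 4 βc)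
    -- `ks` is the unique minimising mode of `Ŵ / Θ` over the nonzero modes in `ℕ^d`
    (ks : Fin d → ℕ) (hks : ks ≠ 0)
    (hmin : ∀ k : Fin d → ℕ, k ≠ 0 → k ≠ ks →
      PorousTransition.coeff W (PorousTransition.natMode ks) /
          PorousTransition.Theta (PorousTransition.natMode ks) <
        PorousTransition.coeff W (PorousTransition.natMode k) /
          PorousTransition.Theta (PorousTransition.natMode k))
    (hnonneg : ∀ k : Fin d → ℕ, k ≠ ks →
      0 ≤ PorousTransition.coeff W (PorousTransition.natMode k))
    (hA2 : ∀ j ∈ PorousTransition.P2 ks, ∀ σ₁ σ₂ : Fin d → ℤˣ,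
      6 * PorousTransition.Theta (PorousTransition.natMode j) ^ 5 *
            PorousTransition.c2 L ks σ₁ σ₂ j ^ 2 *
            ((PorousTransition.P2 ks ∪ PorousTransition.P3 ks).card : ℝ) /
          (PorousTransition.flatDensity d L *
            PorousTransition.Theta (PorousTransition.natMode ks)) *
          |PorousTransition.coeff W (PorousTransition.natMode ks)| <
        PorousTransition.coeff W (PorousTransition.natMode j))
    (hA3 : ∀ l ∈ PorousTransition.P3 ks, ∀ σ₁ σ₂ σ₃ : Fin d → ℤˣ,
      2 * PorousTransition.Theta (PorousTransition.natMode l) ^ 9 *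
            PorousTransition.Theta (PorousTransition.natMode ks) *
            PorousTransition.c3 L ks σ₁ σ₂ σ₃ l ^ 2 *
            ((PorousTransition.P2 ks ∪ PorousTransition.P3 ks).card : ℝ) /
          (3 * PorousTransition.flatDensity d L ^ 2) *
          |PorousTransition.coeff W (PorousTransition.natMode ks)| <
        PorousTransition.coeff W (PorousTransition.natMode l)) :
    βc = PorousTransition.betaSharp W 4 ∧
      PorousTransition.IsContinuousTransitionPoint W 4 βc := by
  -- All other modes in ℕ^d are nonnegative, so the failure of H-stability must come from `ks`.
  have hneg : PorousTransition.coeff W (PorousTransition.natMode ks) < 0 := by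
    obtain ⟨k, hk⟩ := PorousTransition.exists_natMode_coeff_neg hW hWs
    by_cases h : k = ks
    · rwa [h] at hk
    · exact absurd hk (hnonneg k h).not_gt
  have hr := PorousTransition.flatDensity_pos d L
  have hgap := PorousTransition.spectralGap hks hneg hnonneg (fun j hj => hA2 j hj 1 1)
    (fun l hl => hA3 l hl 1 1 1)
  have hb : 0 < -PorousTransition.symbol W (PorousTransition.natMode ks) /
      (4 * PorousTransition.flatDensity d L ^ 2) := by
    refine div_pos (neg_pos.2 ?_) (by positivity)
    rw [PorousTransition.symbol, PorousTransition.absMode_natMode]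
    exact div_neg_of_neg_of_pos hneg (PorousTransition.normConst_pos _)
  rw [PorousTransition.betaSharp_four_eq hks hmin]
  set b := -PorousTransition.symbol W (PorousTransition.natMode ks) /
    (4 * PorousTransition.flatDensity d L ^ 2) with hbdef
  have hb' : 0 < b⁻¹ := inv_pos.2 hb
  have hκ : -PorousTransition.symbol W (PorousTransition.natMode ks) =
      4 * PorousTransition.flatDensity d L ^ 2 * b := by
    rw [hbdef]; field_simp
  rw [hκ] at hgap
  have huniq : PorousTransition.IsUniqueMinimiser W 4 b⁻¹ (PorousTransition.flatState d L) :=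
    PorousTransition.unique_minimiser_of_le hW hks hb hgap (inv_inv b).ge
  have heq : βc = b⁻¹ := by
    refine le_antisymm ?_ ?_
    -- Minimality at βc forbids a negative second variation along the wave of mode `ks`.
    · have h := PorousTransition.linear_stability hW hks fun f hf => by
        have := hβc.critical.energy_le hf
        rwa [PorousTransition.energy_congr PorousTransition.flatState_finite.2] at this
      have h2 : 4 * PorousTransition.flatDensity d L ^ 2 * b ≤
          4 * PorousTransition.flatDensity d L ^ 2 * βc⁻¹ := by linarith
      exact (le_inv_comm₀ hβc.pos hb).2 (le_of_mul_le_mul_left h2 (by positivity))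
    -- If βc < b⁻¹, a nonflat minimiser would exist at b⁻¹, where the flat state is the unique one.
    · by_contra! h
      obtain ⟨ρ, hρ, hρm⟩ := hβc.above _ h
      exact hρ (huniq.2 ρ hρm)
  subst heq
  exact ⟨rfl, hβc, huniq, fun ρ hρ =>
    (PorousTransition.minimisers_tendsto hW hks hb hgap ρ hρ).limsup_eq⟩
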